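/- **Lemma 3.1 (Bourgain's estimate with better constants).** Let $n\ge 3$ and $m\ge 5$ be integers with $m>\xi_m+2\sqrt n$, where $\xi_m:=1$ if $m$ is odd and $\xi_m:=2$ if $m$ is even. Let $\Delta$ be the collection of all half-open $m$-adic cubes $\prod_{i=1}^n[j_i m^{-k},(j_i+1)m^{-k})$, $k,j_1,\dots,j_n\in\mathbb Z$, of side length $m^{-k}$, and let $\vec\Delta$ be the collection of all translates $R+m^{-1}\operatorname{side}(R)\,(j_1,\dots,j_n)$ with $R\in\Delta$ and $j_1,\dots,j_n\in\mathbb Z$. For $A\subset\mathbb R^n$, let $$\mathcal M^s_\infty(A)=\inf\Big\{\sum_{i=1}^\infty(\operatorname{side}E_i)^s:\ A\subset\bigcup_{i=1}^\infty E_i,\ E_i\in\Delta\Big\}.$$ Let $P\in\vec\Delta$ and $P_*\in\Delta$ be any cubes such that $\operatorname{side}P_*=m^{-1}\operatorname{side}P$ and $\overline{P_*}$ contains the center of $P$. Put $Q:=\operatorname{int}P$ and $Q_*:=\overline{P_*}$ (with $\operatorname{side}Q_*=\operatorname{side}P_*$). Then for every closed set $E\subset\mathbb R^n$, every pole $X\in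 Q_*\setminus E$, and every $n-1<s\le n$, the content $\mathcal M^s_\infty(E\cap Q_*)$ is finite and $$\left(\Big(\frac1{\sqrt n}\Big)^{n-2}-\Big(\frac{2}{m-\xi_m}\Big)^{n-2}\right)\frac{\mathcal M^s_\infty(E\cap Q_*)}{(\operatorname{side}Q_*)^s}\ \le\ O(n,m,s)\,\omega^X_{Q\setminus E}(E\cap Q),$$ where $$O(n,m,s)=\min_{k\in\mathbb Z}\left(\Big(\frac{2m^k}{(n-2)\sqrt n}\Big)^{n-2}+\frac{\omega_n}{4}\Big(\frac{mn}{n-2}\Big)^{n-2}\frac{n^3m^{k(n-2-s)}}{1-m^{n-2-s}}\right)$$ (the minimum being attained), $\omega_n$ is the volume of the unit ball of $\mathbb R^n$, and $\omega^X_{Q\setminus E}(A)$ denotes the harmonic measure, with pole $X$, of the bounded open set $Q\setminus E$, that is, the value at $X$ of the Perron solution of the Dirichlet problem in $Q\setminus E$ with boundary values $1$ on $A\cap\partial(Q\setminus E)$ and $0$ on the rest of $\partial(Q\setminus E)$. -/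

import Mathlib

open MeasureTheory Metric Set Filter Topology

noncomputable section

/-! ## Half-open cubes and the `m`-adic grid -/

/-- A half-open axis-parallel cube in `ℝⁿ`, recorded by its lower-left corner and side length. -/
structure HalfOpenCube (n : ℕ) where
  corner : EuclideanSpace ℝ (Fin n)
  side : ℝ

namespace HalfOpenCube

variable {n : ℕ}

/-- The underlying set `∏ᵢ [cornerᵢ, cornerᵢ + side)`. -/
def toSet (Q : HalfOpenCube n) : Set (EuclideanSpace ℝ (Fin n)) :=
  {x | ∀ i, Q.corner i ≤ x i ∧ x i < Q.corner i + Q.side}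

/-- The center of the cube. -/
def center (Q : HalfOpenCube n) : EuclideanSpace ℝ (Fin n) :=
  WithLp.toLp 2 fun i => Q.corner i + Q.side / 2

/-- The translate `Q + v`. -/
def translate (Q : HalfOpenCube n) (v : EuclideanSpace ℝ (Fin n)) : HalfOpenCube n :=
  ⟨Q.corner + v, Q.side⟩

end HalfOpenCube

/-- The grid `Δ^m(ℝⁿ)` of all half-open `m`-adic cubes
`∏ᵢ [jᵢ / m^k, (jᵢ + 1) / m^k)`, with `k, j₁, …, jₙ ∈ ℤ`. -/
def madicGrid (n m : ℕ) : Set (HalfOpenCube n) :=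
  {Q | ∃ (k : ℤ) (j : Fin n → ℤ),
    Q = ⟨WithLp.toLp 2 fun i => (j i : ℝ) / (m : ℝ) ^ k, 1 / (m : ℝ) ^ k⟩}

/-- The translates `Q + m⁻¹ side(Q) (j₁, …, jₙ)` of `m`-adic cubes `Q`, with `j₁, …, jₙ ∈ ℤ`. -/
def alignedGrid (n m : ℕ) : Set (HalfOpenCube n) :=
  {P | ∃ Q ∈ madicGrid n m, ∃ j : Fin n → ℤ,
    P = Q.translate (WithLp.toLp 2 fun i => (m : ℝ)⁻¹ * Q.side * (j i : ℝ))}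

/-- The `s`-dimensional net content `M^s_∞(A)`: the infimum of `∑ (side Eᵢ)^s` over all
countable covers of `A` by `m`-adic cubes `Eᵢ`. -/
def netContent {n : ℕ} (m : ℕ) (s : ℝ) (A : Set (EuclideanSpace ℝ (Fin n))) : ENNReal :=
  ⨅ (c : ℕ → HalfOpenCube n) (_ : ∀ i, c i ∈ madicGrid n m) (_ : A ⊆ ⋃ i, (c i).toSet),
    ∑' i, ENNReal.ofReal ((c i).side ^ s)

/-! ## Harmonic measure -/

/-- A (finite-valued) superharmonic function on the open set `Ω`: a lower semicontinuous
function that is integrable on every closed ball contained in `Ω`, with average over the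
ball at most the value at its center. -/
structure IsSuperharmonicOn {n : ℕ} (v : EuclideanSpace ℝ (Fin n) → ℝ)
    (Ω : Set (EuclideanSpace ℝ (Fin n))) : Prop where
  lsc : LowerSemicontinuousOn v Ω
  integrableOn : ∀ x r, 0 < r → closedBall x r ⊆ Ω → IntegrableOn v (closedBall x r) volume
  average_le : ∀ x r, 0 < r → closedBall x r ⊆ Ω → ⨍ y in closedBall x r, v y ∂volume ≤ v x

/-- The upper Perron class of the boundary function `f : ∂Ω → ℝ` (only the values of `f` on
`∂Ω` are used): superharmonic functions `v` on `Ω`, bounded below, such that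
`liminf_{x → ζ, x ∈ Ω} v x ≥ f ζ` for every `ζ ∈ ∂Ω`. For bounded `f`, restricting to
finite-valued `v` does not affect the infimum below, because superharmonic functions may be
truncated from above at `sup f`. -/
def upperPerronClass {n : ℕ} (Ω : Set (EuclideanSpace ℝ (Fin n)))
    (f : EuclideanSpace ℝ (Fin n) → ℝ) : Set (EuclideanSpace ℝ (Fin n) → ℝ) :=
  {v | IsSuperharmonicOn v Ω ∧ BddBelow (v '' Ω) ∧
    ∀ ζ ∈ frontier Ω, ∀ c < f ζ, ∀ᶠ x in 𝓝[Ω] ζ, c < v x}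

/-- The upper Perron solution at `X` of the Dirichlet problem on the bounded open set `Ω` with
boundary values `f`. -/
def upperPerron {n : ℕ} (Ω : Set (EuclideanSpace ℝ (Fin n)))
    (f : EuclideanSpace ℝ (Fin n) → ℝ) (X : EuclideanSpace ℝ (Fin n)) : ℝ :=
  sInf ((fun v => v X) '' upperPerronClass Ω f)

/-- Harmonic measure `ω^X_Ω(A)` of (the part in `∂Ω` of) a Borel set `A`, with pole `X ∈ Ω`,
for a bounded open set `Ω ⊆ ℝⁿ`: the Perron solution at `X` of the Dirichlet problem on `Ω`
whose boundary values are the indicator function of `A ∩ ∂Ω`. -/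
def harmonicMeasure {n : ℕ} (Ω : Set (EuclideanSpace ℝ (Fin n)))
    (X : EuclideanSpace ℝ (Fin n)) (A : Set (EuclideanSpace ℝ (Fin n))) : ℝ :=
  upperPerron Ω (A.indicator fun _ => 1) X

/-! ## Constants -/

/-- `ξ_m = 1` if `m` is odd and `ξ_m = 2` if `m` is even. -/
def xi (m : ℕ) : ℝ := if Odd m then 1 else 2

/-- The volume of the unit ball of `ℝⁿ`. -/
def unitBallVolume (n : ℕ) : ℝ := volume.real (ball (0 : EuclideanSpace ℝ (Fin n)) 1)

/-- The expression that is minimized over `k ∈ ℤ` in the definition of `O(n,m,s)`. -/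
def bourgainTerm (n m : ℕ) (s : ℝ) (k : ℤ) : ℝ :=
  (2 * (m : ℝ) ^ k / (((n : ℝ) - 2) * √(n : ℝ))) ^ (n - 2)
    + unitBallVolume n / 4 * ((m : ℝ) * (n : ℝ) / ((n : ℝ) - 2)) ^ (n - 2)
      * ((n : ℝ) ^ 3 * (m : ℝ) ^ ((k : ℝ) * ((n : ℝ) - 2 - s))
          / (1 - (m : ℝ) ^ ((n : ℝ) - 2 - s)))

/-- The constant `O(n,m,s)`. -/
def bourgainConst (n m : ℕ) (s : ℝ) : ℝ := sInf (range (bourgainTerm n m s))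

end

/-! The proof tests every function `v` of the upper Perron class against a Newtonian potential of a
Frostman-type measure on `E` inside the small cube. Write `l` for the side of the small cube `C`,
and let `u x = ∑ a i * |y i - x| ^ (2 - n)` be the potential of finitely many masses `a i` at points
`y i` of `E ∩ C`, with total mass `T`.

The masses are chosen so that every grid cell down to a prescribed generation carries mass at most
`side ^ s`, while `T` is at least the net content of `E ∩ C` (`exists_discrete_frostman`). Since `s
> n - 1`, the faces of `C` have content zero, so this is also the content of `E` in the closed cube
(`netContent_inter_closure_le`).

Three bounds on `u` enter. At the pole, `u X ≥ T * (√n * l) ^ (2 - n)`, because `√n * l` is the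
diameter of `C`. Off the large cube, `u ≤ b = T * ((m - ξ) / 2 * l) ^ (2 - n)`, because `(m - ξ) / 2
* l` bounds the margin from below (`aligned_cube_margins`). Away from the support, cutting space
into annuli of ratio `m` and summing a geometric series with ratio `m ^ (n - 2 - s)` gives `u ≤ S`,
where `S` is `bourgainTerm` at a freely chosen `k`, times `l ^ (s - (n - 2))` (`potential_le`). Thus
`(u - b) / S` is at most `0` off the large cube and at most `1` away from `E ∩ C`, so it should lie
below `v`; its value at `X` is the left side of the estimate divided by `bourgainTerm`.

A sum of point masses is unbounded near its atoms, so the comparison must avoid a neighbourhood of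
them. For given `v` and `ε`, already `v > 1 - ε` in a `δ`-neighbourhood of the closure of `E ∩ C`
within the domain (`exists_thickening_comparison`). This `δ` does not depend on the masses, which
are built afterwards, fine enough that `u ≤ S` at distance `δ` from that closure. Hence finite sums
suffice and no limit measure is needed.

The minimum principle behind the comparison (`IsSuperharmonicOn.ge_of_frontier`) requires of the
potential only a sub-mean value inequality up to an error `o(r ^ 2)` in the average. For the kernel
this follows from a second-order Taylor expansion. -/

/-! ### The cells of the `m`-adic grid -/

section Grid

variable {n m : ℕ}

/-- The `m`-adic cube of generation `k` with index `j`. -/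
noncomputable def gridCube (n m : ℕ) (k : ℤ) (j : Fin n → ℤ) : HalfOpenCube n :=
  ⟨WithLp.toLp 2 fun i => (j i : ℝ) / (m : ℝ) ^ k, 1 / (m : ℝ) ^ k⟩

/-- The index of the `m`-adic cube of generation `k` that contains `x`. -/
noncomputable def cellIndex (m : ℕ) (k : ℤ) (x : EuclideanSpace ℝ (Fin n)) : Fin n → ℤ :=
  fun i => ⌊x i * (m : ℝ) ^ k⌋

theorem gridCube_mem_madicGrid (k : ℤ) (j : Fin n → ℤ) : gridCube n m k j ∈ madicGrid n m :=
  ⟨k, j, rfl⟩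

theorem mem_gridCube (hm : 0 < m) {k : ℤ} {j : Fin n → ℤ} {x : EuclideanSpace ℝ (Fin n)} :
    x ∈ (gridCube n m k j).toSet ↔ cellIndex m k x = j := by
  have hpos : (0 : ℝ) < (m : ℝ) ^ k := zpow_pos (by exact_mod_cast hm) k
  rw [funext_iff]
  refine forall_congr' fun i => ?_
  simp only [gridCube, cellIndex, Int.floor_eq_iff]
  rw [← add_div, div_le_iff₀ hpos, lt_div_iff₀ hpos]

theorem cellIndex_eq_div (hm : 0 < m) (k : ℤ) (x : EuclideanSpace ℝ (Fin n)) :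
    cellIndex m k x = fun i => cellIndex m (k + 1) x i / (m : ℤ) := by
  have hpos : (m : ℝ) ≠ 0 := by exact_mod_cast hm.ne'
  funext i
  simp only [cellIndex]
  rw [← Int.floor_div_natCast, zpow_add_one₀ hpos, ← mul_assoc, mul_div_cancel_right₀ _ hpos]

theorem cellIndex_eq_of_le (hm : 0 < m) {k k' : ℤ} (h : k ≤ k')
    {x y : EuclideanSpace ℝ (Fin n)} (hxy : cellIndex m k' x = cellIndex m k' y) :
    cellIndex m k x = cellIndex m k y := by
  induction k', h using Int.leInduction with
  | base => exact hxy
  | succ k' _ ih => exact ih (by rw [cellIndex_eq_div hm k', cellIndex_eq_div hm k', hxy])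

/-- The points of a cube of generation `k` are distributed among its `m ^ n` children. -/
theorem exists_child_index (hm : 0 < m) (k : ℤ) {j : Fin n → ℤ} {x : EuclideanSpace ℝ (Fin n)}
    (hx : cellIndex m k x = j) :
    ∃ c : Fin n → Fin m, cellIndex m (k + 1) x = fun i => (m : ℤ) * j i + (c i : ℤ) := by
  have hm' : (0 : ℤ) < m := by exact_mod_cast hm
  refine ⟨fun i => ⟨(cellIndex m (k + 1) x i % m).toNat, ?_⟩, ?_⟩
  · have := Int.emod_lt_of_pos (cellIndex m (k + 1) x i) hm'
    have := Int.emod_nonneg (cellIndex m (k + 1) x i) hm'.ne'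
    omega
  · funext i
    rw [← hx, cellIndex_eq_div hm k]
    have := Int.emod_nonneg (cellIndex m (k + 1) x i) hm'.ne'
    simp only [Int.toNat_of_nonneg this]
    exact (Int.mul_ediv_add_emod _ _).symm

end Grid

/-! ### Net content -/

section NetContent

variable {n m : ℕ} {s : ℝ}

theorem netContent_mono {A B : Set (EuclideanSpace ℝ (Fin n))} (h : A ⊆ B) :
    netContent m s A ≤ netContent m s B := by
  refine le_iInf fun c => le_iInf fun hc => le_iInf fun hB => ?_
  exact iInf_le_of_le c (iInf_le_of_le hc (iInf_le_of_le (h.trans hB) le_rfl))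

theorem exists_cube_rpow_side_lt (hm : 1 < m) (hs : 0 < s) {ε : ENNReal} (hε : ε ≠ 0) :
    ∃ Q ∈ madicGrid n m, ENNReal.ofReal (Q.side ^ s) < ε := by
  have hm' : (1 : ℝ) < m := by exact_mod_cast hm
  have h1 : Tendsto (fun d : ℕ => ((m : ℝ)⁻¹) ^ d) atTop (𝓝 0) :=
    tendsto_pow_atTop_nhds_zero_of_lt_one (by positivity) (inv_lt_one_of_one_lt₀ hm')
  have h2 : Tendsto (fun d : ℕ => ENNReal.ofReal ((((m : ℝ)⁻¹) ^ d) ^ s)) atTop (𝓝 0) := by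
    have := ENNReal.tendsto_ofReal (h1.rpow_const (p := s) (Or.inr hs.le))
    simpa [Real.zero_rpow hs.ne'] using this
  obtain ⟨d, hd⟩ := (h2.eventually (gt_mem_nhds (pos_iff_ne_zero.2 hε))).exists
  refine ⟨gridCube n m d 0, gridCube_mem_madicGrid _ _, ?_⟩
  simpa [gridCube] using hd

/-- Covers are indexed by all of `ℕ` and a grid cube is never degenerate, so the one-cube cover is
padded with cubes whose total contribution is below `ε`. -/
theorem netContent_le_rpow_side (hm : 1 < m) (hs : 0 < s) {A : Set (EuclideanSpace ℝ (Fin n))}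
    {Q : HalfOpenCube n} (hQ : Q ∈ madicGrid n m) (hA : A ⊆ Q.toSet) :
    netContent m s A ≤ ENNReal.ofReal (Q.side ^ s) := by
  refine ENNReal.le_of_forall_pos_le_add fun ε hε _ => ?_
  obtain ⟨δ, hδ, hsum⟩ := ENNReal.exists_pos_sum_of_countable' (ENNReal.coe_pos.2 hε).ne' ℕ
  choose c hc hcδ using fun i =>
    exists_cube_rpow_side_lt (n := n) hm hs (pos_iff_ne_zero.1 (hδ i))
  let c' : ℕ → HalfOpenCube n := fun i => Nat.casesOn i Q c
  have hc' : ∀ i, c' i ∈ madicGrid n m := by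
    intro i
    cases i with
    | zero => exact hQ
    | succ i => exact hc i
  refine iInf_le_of_le c' (iInf_le_of_le hc' (iInf_le_of_le
    (hA.trans (subset_iUnion (fun i => (c' i).toSet) 0)) ?_))
  rw [tsum_eq_zero_add' ENNReal.summable]
  exact add_le_add le_rfl ((ENNReal.tsum_le_tsum fun i => (hcδ i).le).trans hsum.le)

theorem netContent_empty (hm : 1 < m) (hs : 0 < s) :
    netContent m s (∅ : Set (EuclideanSpace ℝ (Fin n))) = 0 := by
  by_contra h
  obtain ⟨Q, hQ, hlt⟩ := exists_cube_rpow_side_lt (n := n) hm hs h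
  exact (netContent_le_rpow_side hm hs hQ (empty_subset _)).not_gt hlt

theorem netContent_iUnion_le (A : ℕ → Set (EuclideanSpace ℝ (Fin n))) :
    netContent m s (⋃ i, A i) ≤ ∑' i, netContent m s (A i) := by
  refine ENNReal.le_of_forall_pos_le_add fun ε hε hfin => ?_
  obtain ⟨δ, hδ, hsum⟩ := ENNReal.exists_pos_sum_of_countable' (ENNReal.coe_pos.2 hε).ne' ℕ
  have hlt : ∀ i, ∃ c : ℕ → HalfOpenCube n, (∀ k, c k ∈ madicGrid n m) ∧
      (A i ⊆ ⋃ k, (c k).toSet) ∧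
      ∑' k, ENNReal.ofReal ((c k).side ^ s) < netContent m s (A i) + δ i := by
    intro i
    have h : netContent m s (A i) < netContent m s (A i) + δ i :=
      ENNReal.lt_add_right (ENNReal.ne_top_of_tsum_ne_top hfin.ne i) (pos_iff_ne_zero.1 (hδ i))
    conv_lhs at h => rw [netContent]
    simpa only [iInf_lt_iff, exists_prop] using h
  choose c hc hA hcδ using hlt
  refine iInf_le_of_le (fun k => c k.unpair.1 k.unpair.2) (iInf_le_of_le (fun k => hc _ _)
    (iInf_le_of_le ?_ ?_))
  · refine iUnion_subset fun i x hx => ?_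
    obtain ⟨k, hk⟩ := mem_iUnion.1 (hA i hx)
    exact mem_iUnion.2 ⟨Nat.pair i k, by simpa using hk⟩
  · calc ∑' k : ℕ, ENNReal.ofReal ((c k.unpair.1 k.unpair.2).side ^ s)
        = ∑' p : ℕ × ℕ, ENNReal.ofReal ((c p.1 p.2).side ^ s) :=
          Nat.pairEquiv.symm.tsum_eq (fun p : ℕ × ℕ => ENNReal.ofReal ((c p.1 p.2).side ^ s))
      _ = ∑' i, ∑' k, ENNReal.ofReal ((c i k).side ^ s) :=
          ENNReal.tsum_prod (f := fun i k => ENNReal.ofReal ((c i k).side ^ s))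
      _ ≤ ∑' i, (netContent m s (A i) + δ i) := ENNReal.tsum_le_tsum fun i => (hcδ i).le
      _ ≤ ∑' i, netContent m s (A i) + ε := by
          rw [ENNReal.tsum_add]
          exact add_le_add le_rfl hsum.le

/-- Net content as an outer measure. -/
noncomputable def netOuterMeasure (n : ℕ) (hm : 1 < m) (hs : 0 < s) :
    OuterMeasure (EuclideanSpace ℝ (Fin n)) where
  measureOf := netContent m s
  empty := netContent_empty hm hs
  mono := netContent_mono
  iUnion_nat A _ := netContent_iUnion_le A

theorem netContent_union_le (hm : 1 < m) (hs : 0 < s) (A B : Set (EuclideanSpace ℝ (Fin n))) :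
    netContent m s (A ∪ B) ≤ netContent m s A + netContent m s B :=
  measure_union_le (μ := netOuterMeasure n hm hs) A B

theorem netContent_iUnion_fintype_le {ι : Type*} [Fintype ι] (hm : 1 < m) (hs : 0 < s)
    (A : ι → Set (EuclideanSpace ℝ (Fin n))) :
    netContent m s (⋃ i, A i) ≤ ∑ i, netContent m s (A i) :=
  measure_iUnion_fintype_le (netOuterMeasure n hm hs) A

theorem netContent_le_card_mul (hm : 1 < m) (hs : 0 < s) {A : Set (EuclideanSpace ℝ (Fin n))}
    (k : ℤ) (I : Finset (Fin n → ℤ)) (hA : ∀ x ∈ A, cellIndex m k x ∈ I) :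
    netContent m s A ≤ I.card * ENNReal.ofReal ((1 / (m : ℝ) ^ k) ^ s) := by
  have hsub : A ⊆ ⋃ j ∈ I, (gridCube n m k j).toSet := fun x hx =>
    mem_biUnion (hA x hx) ((mem_gridCube (by omega)).2 rfl)
  refine (netContent_mono hsub).trans ((measure_biUnion_finset_le (μ := netOuterMeasure n hm hs)
    I _).trans ?_)
  rw [← nsmul_eq_mul]
  exact Finset.sum_le_card_nsmul _ _ _ fun j _ =>
    netContent_le_rpow_side hm hs (gridCube_mem_madicGrid k j) subset_rfl

/-- The faces of an `m`-adic cube have zero content when `s > n - 1`. -/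
theorem netContent_face_eq_zero (hm : 1 < m) (hs : 0 < s) (hs₁ : (n : ℝ) - 1 < s) (k : ℤ)
    (j : Fin n → ℤ) (i₀ : Fin n) :
    netContent m s {x : EuclideanSpace ℝ (Fin n) | x i₀ * (m : ℝ) ^ k = j i₀ + 1 ∧
      ∀ i, (j i : ℝ) ≤ x i * (m : ℝ) ^ k ∧ x i * (m : ℝ) ^ k ≤ j i + 1} = 0 := by
  set A := {x : EuclideanSpace ℝ (Fin n) | x i₀ * (m : ℝ) ^ k = j i₀ + 1 ∧
      ∀ i, (j i : ℝ) ≤ x i * (m : ℝ) ^ k ∧ x i * (m : ℝ) ^ k ≤ j i + 1}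
  have hm0 : (0 : ℝ) < m := by positivity
  have hm1 : (1 : ℝ) < m := by exact_mod_cast hm
  have hk0 : (0 : ℝ) < (m : ℝ) ^ k := zpow_pos hm0 k
  have key : ∀ d : ℕ, netContent m s A ≤ ENNReal.ofReal
      (2 ^ (n - 1) * (1 / (m : ℝ) ^ k) ^ s * (((m : ℝ) ^ ((n : ℝ) - 1 - s)) ^ d)) := by
    intro d
    -- The cells of generation `k + d` that meet the face: coordinate `i₀` has one possible index,
    -- every other coordinate has `m ^ d + 1`, the extra one because the face is closed. Their
    -- number grows like `m ^ (d * (n - 1))`, which loses against `m ^ (-d * s)`.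
    let I : Finset (Fin n → ℤ) := Fintype.piFinset fun i =>
      if i = i₀ then {(j i + 1) * (m : ℤ) ^ d} else
        Finset.Icc (j i * (m : ℤ) ^ d) ((j i + 1) * (m : ℤ) ^ d)
    have hI : ∀ x ∈ A, cellIndex m (k + d) x ∈ I := by
      intro x hx
      refine Fintype.mem_piFinset.2 fun i => ?_
      have e : x i * (m : ℝ) ^ (k + d : ℤ) = x i * (m : ℝ) ^ k * (m : ℝ) ^ d := by
        rw [zpow_add₀ hm0.ne', zpow_natCast, mul_assoc]
      simp only [cellIndex, e]
      split_ifs with h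
      · subst h
        rw [hx.1, Finset.mem_singleton]
        have : ((j i : ℝ) + 1) * (m : ℝ) ^ d = (((j i + 1) * (m : ℤ) ^ d : ℤ) : ℝ) := by
          push_cast; ring
        rw [this, Int.floor_intCast]
      · obtain ⟨h1, h2⟩ := hx.2 i
        rw [Finset.mem_Icc]
        constructor
        · apply Int.le_floor.2
          push_cast
          gcongr
        · rw [← Int.cast_le (R := ℝ)]
          refine (Int.floor_le _).trans ?_
          push_cast
          gcongr
    have hcard : I.card = (m ^ d + 1) ^ (n - 1) := by
      rw [Fintype.card_piFinset, ← Finset.mul_prod_erase _ _ (Finset.mem_univ i₀)]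
      simp only [if_true, Finset.card_singleton, one_mul]
      rw [Finset.prod_congr rfl (g := fun _ => m ^ d + 1), Finset.prod_const,
        Finset.card_erase_of_mem (Finset.mem_univ _), Finset.card_univ, Fintype.card_fin]
      intro i hi
      rw [if_neg (Finset.ne_of_mem_erase hi), Int.card_Icc]
      have : (j i + 1) * (m : ℤ) ^ d + 1 - j i * (m : ℤ) ^ d = ((m ^ d + 1 : ℕ) : ℤ) := by
        push_cast; ring
      rw [this, Int.toNat_natCast]
    refine (netContent_le_card_mul hm hs (k + d) I hI).trans ?_
    rw [← ENNReal.ofReal_natCast, ← ENNReal.ofReal_mul (by positivity), hcard]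
    refine ENNReal.ofReal_le_ofReal ?_
    have hn : ((n - 1 : ℕ) : ℝ) = n - 1 := by
      rw [Nat.cast_sub (by have := i₀.2; omega)]; simp
    have hM : (1 : ℝ) ≤ (m : ℝ) ^ d := one_le_pow₀ hm1.le
    have hM0 : (0 : ℝ) < (m : ℝ) ^ d := by positivity
    have e1 : (1 / (m : ℝ) ^ (k + d : ℤ)) ^ s
        = (1 / (m : ℝ) ^ k) ^ s * (((m : ℝ) ^ d) ^ s)⁻¹ := by
      rw [zpow_add₀ hm0.ne', zpow_natCast, one_div, mul_inv, Real.mul_rpow (by positivity)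
        (by positivity), one_div, Real.inv_rpow hM0.le]
    have e2 : ((m : ℝ) ^ ((n : ℝ) - 1 - s)) ^ d
        = ((m : ℝ) ^ d) ^ (n - 1) * (((m : ℝ) ^ d) ^ s)⁻¹ := by
      rw [Real.rpow_pow_comm hm0.le, Real.rpow_sub hM0, ← hn, Real.rpow_natCast, div_eq_mul_inv]
    rw [e1, e2]
    push_cast
    calc ((m : ℝ) ^ d + 1) ^ (n - 1) * ((1 / (m : ℝ) ^ k) ^ s * (((m : ℝ) ^ d) ^ s)⁻¹)
        ≤ (2 * (m : ℝ) ^ d) ^ (n - 1) * ((1 / (m : ℝ) ^ k) ^ s * (((m : ℝ) ^ d) ^ s)⁻¹) := by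
          gcongr
          linarith
      _ = _ := by rw [mul_pow]; ring
  have hlim : Tendsto (fun d : ℕ => ENNReal.ofReal
      (2 ^ (n - 1) * (1 / (m : ℝ) ^ k) ^ s * (((m : ℝ) ^ ((n : ℝ) - 1 - s)) ^ d))) atTop (𝓝 0) := by
    have h1 : Tendsto (fun d : ℕ => ((m : ℝ) ^ ((n : ℝ) - 1 - s)) ^ d) atTop (𝓝 0) :=
      tendsto_pow_atTop_nhds_zero_of_lt_one (by positivity)
        (Real.rpow_lt_one_of_one_lt_of_neg hm1 (by linarith))
    simpa using ENNReal.tendsto_ofReal (h1.const_mul (2 ^ (n - 1) * (1 / (m : ℝ) ^ k) ^ s))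
  exact le_antisymm (ge_of_tendsto' hlim key) bot_le

theorem closure_gridCube_subset (hm : 0 < m) (k : ℤ) (j : Fin n → ℤ) :
    closure (gridCube n m k j).toSet ⊆
      {x | ∀ i, (j i : ℝ) ≤ x i * (m : ℝ) ^ k ∧ x i * (m : ℝ) ^ k ≤ j i + 1} := by
  refine closure_minimal ?_ ?_
  · intro x hx i
    have := congrFun ((mem_gridCube hm).1 hx) i
    rw [cellIndex, Int.floor_eq_iff] at this
    exact ⟨this.1, this.2.le⟩
  · simp only [Set.ofPred_forall, Set.ofPred_and]
    exact isClosed_iInter fun i => (isClosed_le continuous_const (by fun_prop)).inter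
      (isClosed_le (by fun_prop) continuous_const)

/-- The boundary of an `m`-adic cube does not contribute to the content when `s > n - 1`. -/
theorem netContent_inter_closure_le (hm : 1 < m) (hs : 0 < s) (hs₁ : (n : ℝ) - 1 < s) (k : ℤ)
    (j : Fin n → ℤ) (E : Set (EuclideanSpace ℝ (Fin n))) :
    netContent m s (E ∩ closure (gridCube n m k j).toSet) ≤
      netContent m s (E ∩ (gridCube n m k j).toSet) := by
  have hsub : E ∩ closure (gridCube n m k j).toSet ⊆ (E ∩ (gridCube n m k j).toSet) ∪
      ⋃ i₀, {x : EuclideanSpace ℝ (Fin n) | x i₀ * (m : ℝ) ^ k = j i₀ + 1 ∧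
      ∀ i, (j i : ℝ) ≤ x i * (m : ℝ) ^ k ∧ x i * (m : ℝ) ^ k ≤ j i + 1} := by
    rintro x ⟨hxE, hx⟩
    have hx' := closure_gridCube_subset (by omega) k j hx
    by_cases h : ∃ i₀, x i₀ * (m : ℝ) ^ k = j i₀ + 1
    · obtain ⟨i₀, h⟩ := h
      exact Or.inr (mem_iUnion.2 ⟨i₀, h, hx'⟩)
    · push Not at h
      refine Or.inl ⟨hxE, (mem_gridCube (by omega)).2 (funext fun i => ?_)⟩
      exact Int.floor_eq_iff.2 ⟨(hx' i).1, lt_of_le_of_ne (hx' i).2 (h i)⟩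
  refine (netContent_mono hsub).trans ((netContent_union_le hm hs _ _).trans ?_)
  have h0 := netContent_iUnion_fintype_le hm hs fun i₀ => {x : EuclideanSpace ℝ (Fin n) |
      x i₀ * (m : ℝ) ^ k = j i₀ + 1 ∧
      ∀ i, (j i : ℝ) ≤ x i * (m : ℝ) ^ k ∧ x i * (m : ℝ) ^ k ≤ j i + 1}
  simp only [netContent_face_eq_zero hm hs hs₁, Finset.sum_const_zero] at h0
  exact (add_le_add le_rfl h0).trans (add_zero _).le

end NetContent

/-! ### A discrete Frostman lemma -/

section Frostman

variable {n m : ℕ} {s : ℝ}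

/-- Used to merge the mass systems of the children of a cube: a cell strictly finer than the cube
meets at most one child, so the bound valid in each child survives the union. -/
theorem sum_sigma_filter_le {κ : Type*} [Fintype κ] {ι : κ → Type*} [∀ c, Fintype (ι c)]
    (a : ∀ c, ι c → ℝ) (p : ∀ c, ι c → Prop) [∀ c, DecidablePred (p c)]
    (hp : ∀ c c' i i', p c i → p c' i' → c = c') {b : ℝ} (hb0 : 0 ≤ b)
    (hb : ∀ c, ∑ i with p c i, a c i ≤ b) :
    ∑ q : (Σ c, ι c) with p q.1 q.2, a q.1 q.2 ≤ b := by
  classical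
  rw [Finset.sum_filter, Fintype.sum_sigma]
  simp only [← Finset.sum_filter]
  by_cases h : ∃ c i, p c i
  · obtain ⟨c, i, hci⟩ := h
    rw [Finset.sum_eq_single c]
    · exact hb c
    · intro c' _ hne
      refine Finset.sum_eq_zero fun i' hi' => ?_
      exact absurd (hp _ _ _ _ (Finset.mem_filter.1 hi').2 hci) hne
    · simp
  · push Not at h
    rw [Finset.sum_eq_zero]
    · exact hb0
    · intro c _
      exact Finset.sum_eq_zero fun i hi => absurd (Finset.mem_filter.1 hi).2 (h c i)

/-- In each cube there is a finite system of point masses on `A`, of total mass at least the net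
content of `A` in the cube, whose mass on subcubes of the next `d` generations is controlled by
the power `s` of the side. -/
theorem exists_discrete_frostman (hm : 1 < m) (hs : 0 < s)
    (A : Set (EuclideanSpace ℝ (Fin n))) (d : ℕ) : ∀ (k : ℤ) (j : Fin n → ℤ),
    ∃ (ι : Type) (_ : Fintype ι) (y : ι → EuclideanSpace ℝ (Fin n)) (a : ι → ℝ),
      (∀ i, 0 ≤ a i) ∧ (∀ i, y i ∈ A ∧ cellIndex m k (y i) = j) ∧
      (∀ k', k ≤ k' → k' ≤ k + d → ∀ j',
        ∑ i with cellIndex m k' (y i) = j', a i ≤ (1 / (m : ℝ) ^ k') ^ s) ∧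
      netContent m s (A ∩ (gridCube n m k j).toSet) ≤ ENNReal.ofReal (∑ i, a i) := by
  have hm0 : 0 < m := by omega
  induction d with
  | zero =>
    intro k j
    have hside : (gridCube n m k j).side = 1 / (m : ℝ) ^ k := rfl
    by_cases h : (A ∩ (gridCube n m k j).toSet).Nonempty
    · obtain ⟨y, hyA, hy⟩ := h
      refine ⟨Unit, inferInstance, fun _ => y, fun _ => (1 / (m : ℝ) ^ k) ^ s, fun _ => by
        positivity, fun _ => ⟨hyA, (mem_gridCube hm0).1 hy⟩, ?_, ?_⟩
      · intro k' h1 h2 j'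
        obtain rfl : k' = k := by push_cast at h2; omega
        rw [Finset.sum_filter]
        simp only [Finset.univ_unique, Finset.sum_singleton]
        split_ifs
        · exact le_rfl
        · positivity
      · simpa [hside] using netContent_le_rpow_side hm hs (gridCube_mem_madicGrid k j)
          (inter_subset_right (s := A))
    · rw [not_nonempty_iff_eq_empty] at h
      refine ⟨Empty, inferInstance, Empty.elim, Empty.elim, fun i => i.elim, fun i => i.elim,
        ?_, ?_⟩
      · intro k' _ _ j'
        simp only [Finset.univ_eq_empty, Finset.filter_empty, Finset.sum_empty]
        positivity
      · rw [h, netContent_empty hm hs]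
        exact bot_le
  | succ d ih =>
    intro k j
    choose ι hι y a ha hy hsum hM using fun c : Fin n → Fin m =>
      ih (k + 1) (fun i => (m : ℤ) * j i + (c i : ℤ))
    have hcell : ∀ c i, cellIndex m k (y c i) = j := by
      intro c i
      rw [cellIndex_eq_div hm0, (hy c i).2]
      funext i'
      rw [Int.add_ediv_of_dvd_left (dvd_mul_right _ _), Int.mul_ediv_cancel_left _ (by omega),
        Int.ediv_eq_zero_of_lt (by omega) (by have := (c i').2; omega), add_zero]
    have hcover : netContent m s (A ∩ (gridCube n m k j).toSet) ≤
        ENNReal.ofReal (∑ q : (Σ c, ι c), a q.1 q.2) := by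
      have hsub : A ∩ (gridCube n m k j).toSet ⊆ ⋃ c : Fin n → Fin m,
          A ∩ (gridCube n m (k + 1) (fun i => (m : ℤ) * j i + (c i : ℤ))).toSet := by
        rintro x ⟨hxA, hx⟩
        obtain ⟨c, hc⟩ := exists_child_index hm0 k ((mem_gridCube hm0).1 hx)
        exact mem_iUnion.2 ⟨c, hxA, (mem_gridCube hm0).2 hc⟩
      refine (netContent_mono hsub).trans ((netContent_iUnion_fintype_le hm hs _).trans ?_)
      rw [Fintype.sum_sigma, ENNReal.ofReal_sum_of_nonneg fun c _ =>
        Finset.sum_nonneg fun i _ => ha c i]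
      exact Finset.sum_le_sum fun c _ => hM c
    set T := ∑ q : (Σ c, ι c), a q.1 q.2 with hT
    have hT0 : 0 ≤ T := Finset.sum_nonneg fun q _ => ha q.1 q.2
    set b : ℝ := (1 / (m : ℝ) ^ k) ^ s with hb
    have hb0 : 0 < b := by positivity
    -- The masses inherited from the children are kept if they respect the bound on the parent and
    -- are otherwise scaled down to total exactly `side ^ s`. In the first case the content is
    -- controlled by subadditivity over the children, in the second by the parent itself as a cover.
    obtain ⟨r, hr0, hr1, hrT, hrM⟩ : ∃ r : ℝ, 0 ≤ r ∧ r ≤ 1 ∧ r * T ≤ b ∧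
        netContent m s (A ∩ (gridCube n m k j).toSet) ≤ ENNReal.ofReal (r * T) := by
      rcases le_total T b with h | h
      · exact ⟨1, zero_le_one, le_rfl, by simpa using h, by simpa using hcover⟩
      · have hTpos : 0 < T := hb0.trans_le h
        have e : b / T * T = b := div_mul_cancel₀ _ hTpos.ne'
        refine ⟨b / T, by positivity, (div_le_one hTpos).2 h, e.le, ?_⟩
        rw [e]
        exact netContent_le_rpow_side hm hs (gridCube_mem_madicGrid k j) inter_subset_right
    refine ⟨Σ c, ι c, inferInstance, fun q => y q.1 q.2, fun q => r * a q.1 q.2,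
      fun q => mul_nonneg hr0 (ha _ _), fun q => ⟨(hy _ _).1, hcell _ _⟩, ?_, ?_⟩
    · intro k' h1 h2 j'
      rw [← Finset.mul_sum]
      rcases h1.eq_or_lt with rfl | h1
      · refine (mul_le_mul_of_nonneg_left ?_ hr0).trans hrT
        exact Finset.sum_le_sum_of_subset_of_nonneg (Finset.filter_subset _ _)
          fun q _ _ => ha q.1 q.2
      · have h3 : ∑ q : (Σ c, ι c) with cellIndex m k' (y q.1 q.2) = j', a q.1 q.2 ≤
            (1 / (m : ℝ) ^ k') ^ s := by
          refine sum_sigma_filter_le a (fun c i => cellIndex m k' (y c i) = j') ?_ (by positivity)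
            fun c => hsum c k' (by omega) (by push_cast at h2; omega) j'
          intro c c' i i' e e'
          have := cellIndex_eq_of_le hm0 (show k + 1 ≤ k' by omega) (e.trans e'.symm)
          rw [(hy c i).2, (hy c' i').2] at this
          funext i₀
          have := congrFun this i₀
          exact Fin.ext (by simpa using this)
        exact (mul_le_of_le_one_left (Finset.sum_nonneg fun q _ => ha q.1 q.2) hr1).trans h3
    · rwa [← Finset.mul_sum]

end Frostman

/-! ### Counting grid cells in a ball -/

section Counting

variable {n m : ℕ} {s : ℝ}

theorem volume_gridCube (hm : 0 < m) (k : ℤ) (j : Fin n → ℤ) :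
    volume (gridCube n m k j).toSet = ENNReal.ofReal ((1 / (m : ℝ) ^ k) ^ n) := by
  have h : (gridCube n m k j).toSet = (WithLp.ofLp : EuclideanSpace ℝ (Fin n) → Fin n → ℝ) ⁻¹'
      (Set.pi univ fun i => Ico ((j i : ℝ) / (m : ℝ) ^ k) ((j i : ℝ) / (m : ℝ) ^ k
        + 1 / (m : ℝ) ^ k)) := by
    ext x
    simp [HalfOpenCube.toSet, gridCube]
  rw [h, (PiLp.volume_preserving_ofLp (Fin n)).measure_preimage
    (MeasurableSet.univ_pi fun i => measurableSet_Ico).nullMeasurableSet, Real.volume_pi_Ico]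
  simp only [add_sub_cancel_left, Finset.prod_const, Finset.card_univ, Fintype.card_fin]
  rw [ENNReal.ofReal_pow]
  positivity

theorem measurableSet_gridCube (k : ℤ) (j : Fin n → ℤ) :
    MeasurableSet (gridCube n m k j).toSet := by
  have : (gridCube n m k j).toSet = ⋂ i, ({x | (gridCube n m k j).corner i ≤ x i} ∩
      {x | x i < (gridCube n m k j).corner i + (gridCube n m k j).side}) := by
    ext x; simp [HalfOpenCube.toSet]
  rw [this]
  refine MeasurableSet.iInter fun i => MeasurableSet.inter ?_ ?_
  · exact measurableSet_le measurable_const (by fun_prop)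
  · exact measurableSet_lt (by fun_prop) measurable_const

/-- Two points whose coordinates differ by at most `h` are at distance at most `√n * h`. -/
theorem dist_le_sqrt_mul {x y : EuclideanSpace ℝ (Fin n)} {h : ℝ} (hh : 0 ≤ h)
    (hxy : ∀ i, |x i - y i| ≤ h) : dist x y ≤ √n * h := by
  rw [EuclideanSpace.dist_eq, ← Real.sqrt_sq hh, ← Real.sqrt_mul (Nat.cast_nonneg n)]
  refine Real.sqrt_le_sqrt ?_
  calc ∑ i, dist (x i) (y i) ^ 2 ≤ ∑ _i : Fin n, h ^ 2 := by
        refine Finset.sum_le_sum fun i _ => ?_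
        rw [Real.dist_eq]
        exact pow_le_pow_left₀ (abs_nonneg _) (hxy i) 2
    _ = n * h ^ 2 := by simp

theorem dist_le_of_cellIndex_eq (hm : 0 < m) (k : ℤ) {x y : EuclideanSpace ℝ (Fin n)}
    (hxy : cellIndex m k x = cellIndex m k y) : dist x y ≤ √n * (1 / (m : ℝ) ^ k) := by
  have hpos : (0 : ℝ) < (m : ℝ) ^ k := zpow_pos (by exact_mod_cast hm) k
  refine dist_le_sqrt_mul (by positivity) fun i => ?_
  rw [le_div_iff₀ hpos]
  nth_rewrite 1 [← abs_of_pos hpos]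
  rw [← abs_mul, sub_mul]
  exact (Int.abs_sub_lt_one_of_floor_eq_floor (congrFun hxy i)).le

/-- Volume packing: the cells are disjoint and, having diameter at most `√n` times their side, all
lie in the ball enlarged by that amount. -/
theorem card_cells_le (hm : 0 < m) (k : ℤ) (x : EuclideanSpace ℝ (Fin n)) {r : ℝ} (hr : 0 ≤ r)
    (I : Finset (Fin n → ℤ)) (hI : ∀ j ∈ I, ∃ y, cellIndex m k y = j ∧ dist y x ≤ r) :
    (I.card : ℝ) * (1 / (m : ℝ) ^ k) ^ n ≤
      (r + √n * (1 / (m : ℝ) ^ k)) ^ n * unitBallVolume n := by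
  have hpos : (0 : ℝ) < (m : ℝ) ^ k := zpow_pos (by exact_mod_cast hm) k
  have hsub : (⋃ j ∈ I, (gridCube n m k j).toSet) ⊆
      closedBall x (r + √n * (1 / (m : ℝ) ^ k)) := by
    refine iUnion₂_subset fun j hj z hz => ?_
    obtain ⟨y, hy, hyx⟩ := hI j hj
    have := dist_le_of_cellIndex_eq hm k (((mem_gridCube hm).1 hz).trans hy.symm)
    rw [mem_closedBall]
    linarith [dist_triangle z y x]
  have hvol := measure_mono (μ := volume) hsub
  rw [measure_biUnion_finset (fun j _ j' _ hjj' => ?_) fun j _ => measurableSet_gridCube k j] at hvol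
  · simp only [volume_gridCube hm, Finset.sum_const, nsmul_eq_mul] at hvol
    have h2 := ENNReal.toReal_mono measure_closedBall_lt_top.ne hvol
    rw [ENNReal.toReal_mul, ENNReal.toReal_ofReal (by positivity), ENNReal.toReal_natCast] at h2
    refine h2.trans_eq ?_
    have := Measure.addHaar_real_closedBall (volume : Measure (EuclideanSpace ℝ (Fin n))) x
      (r := r + √n * (1 / (m : ℝ) ^ k)) (by positivity)
    rw [finrank_euclideanSpace_fin] at this
    exact this
  · refine Set.disjoint_left.2 fun z hz hz' => hjj' ?_
    exact ((mem_gridCube hm).1 hz).symm.trans ((mem_gridCube hm).1 hz')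

/-- The mass of a ball under point masses that are controlled on the cells of generation `k`. -/
theorem sum_ball_le (hm : 0 < m) (k : ℤ) {ι : Type*} [Fintype ι]
    (y : ι → EuclideanSpace ℝ (Fin n)) (a : ι → ℝ) {b : ℝ} (hb : 0 ≤ b)
    (hab : ∀ j, ∑ i with cellIndex m k (y i) = j, a i ≤ b) (ha : ∀ i, 0 ≤ a i)
    (x : EuclideanSpace ℝ (Fin n)) {ρ : ℝ} (hρ : 0 ≤ ρ) :
    ∑ i with dist (y i) x < ρ * (1 / (m : ℝ) ^ k), a i ≤
      (ρ + √n) ^ n * unitBallVolume n * b := by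
  classical
  have hpos : (0 : ℝ) < (m : ℝ) ^ k := zpow_pos (by exact_mod_cast hm) k
  set t := Finset.univ.filter fun i => dist (y i) x < ρ * (1 / (m : ℝ) ^ k) with ht
  set I := t.image fun i => cellIndex m k (y i) with hI
  have hcard := card_cells_le hm k x (r := ρ * (1 / (m : ℝ) ^ k)) (by positivity) I (by
    intro j hj
    obtain ⟨i, hi, rfl⟩ := Finset.mem_image.1 hj
    exact ⟨y i, rfl, (Finset.mem_filter.1 hi).2.le⟩)
  rw [← add_mul, mul_pow, mul_right_comm] at hcard
  have hcard' := le_of_mul_le_mul_right hcard (by positivity)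
  have hsum : ∑ i ∈ t, a i ≤ I.card • b := by
    rw [← Finset.sum_fiberwise_of_maps_to (t := I) (g := fun i => cellIndex m k (y i))
      fun i hi => Finset.mem_image_of_mem _ hi]
    refine Finset.sum_le_card_nsmul _ _ _ fun j _ => (Finset.sum_le_sum_of_subset_of_nonneg ?_
      fun i _ _ => ha i).trans (hab j)
    exact Finset.filter_subset_filter _ (Finset.subset_univ _)
  rw [nsmul_eq_mul] at hsum
  exact hsum.trans (mul_le_mul_of_nonneg_right hcard' hb)

end Counting

/-! ### The bound for the potential -/

section Potential

variable {n m : ℕ} {s : ℝ}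

/-- If `q + 1` is the first index with `r (q + 1) ≤ D`, then `D < r q` and the summand at `q` alone
dominates; if already `r 0 ≤ D`, the leading term does. -/
theorem inv_pow_le_sum_annuli (β : ℕ) (r : ℕ → ℝ) (hr : ∀ q, 0 < r q) {D : ℝ} (J : ℕ)
    (hD : r J ≤ D) :
    (D ^ β)⁻¹ ≤ (r 0 ^ β)⁻¹ +
      ∑ q ∈ Finset.range J, if D < r q then (r (q + 1) ^ β)⁻¹ else 0 := by
  induction J with
  | zero =>
    have := hr 0
    simp only [Finset.range_zero, Finset.sum_empty, add_zero]
    gcongr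
  | succ J ih =>
    have hr1 := hr (J + 1)
    have hr0 := hr 0
    rw [Finset.sum_range_succ]
    rcases le_or_gt (r J) D with h | h
    · have := ih h
      rw [if_neg h.not_gt]
      linarith
    · rw [if_pos h]
      have h1 : (D ^ β)⁻¹ ≤ (r (J + 1) ^ β)⁻¹ := by gcongr
      have h2 : 0 ≤ ∑ q ∈ Finset.range J, if D < r q then (r (q + 1) ^ β)⁻¹ else 0 :=
        Finset.sum_nonneg fun q _ => by have := hr (q + 1); split_ifs <;> positivity
      have h3 : 0 ≤ (r 0 ^ β)⁻¹ := by positivity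
      linarith

/-- With inner radius factor `ρ = (n - 2) * √n / 2` one has `ρ + √n = n * √n / 2`, so the powers of
`√n` and `2` cancel up to `n ^ 3 / 4`. The factor `m ^ (n - 2)` comes from bounding the kernel by
the inner radius, which is `m` times smaller than the outer one. -/
theorem annulus_constant (hn : 3 ≤ n) (hm : 1 < m) (k : ℤ) (q : ℕ) {l : ℝ} (hl : 0 < l) :
    ((((n : ℝ) - 2) * √n / 2 * (l / ((m : ℝ) ^ k * m ^ (q + 1)))) ^ (n - 2))⁻¹ *
      ((((n : ℝ) - 2) * √n / 2 + √n) ^ n * unitBallVolume n * (l / ((m : ℝ) ^ k * m ^ q)) ^ s) =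
    unitBallVolume n / 4 * ((m : ℝ) * n / ((n : ℝ) - 2)) ^ (n - 2) *
      ((n : ℝ) ^ 3 * (m : ℝ) ^ ((k : ℝ) * ((n : ℝ) - 2 - s))) *
      ((m : ℝ) ^ ((n : ℝ) - 2 - s)) ^ q * (l ^ s * (l ^ (n - 2))⁻¹) := by
  obtain ⟨β, rfl⟩ : ∃ β, n = β + 2 := ⟨n - 2, by omega⟩
  have hm0 : (0 : ℝ) < m := by positivity
  have hβ : (0 : ℝ) < β := by exact_mod_cast (show 0 < β by omega)
  have hcast : ((β + 2 : ℕ) : ℝ) - 2 = β := by push_cast; ring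
  rw [hcast, show β + 2 - 2 = β from rfl]
  set N : ℝ := ((β + 2 : ℕ) : ℝ) with hN
  have hN0 : 0 < N := by positivity
  have hNβ : N = β + 2 := by rw [hN]; push_cast; ring
  set M : ℝ := (m : ℝ) ^ k * m ^ q with hM
  have hM0 : 0 < M := by positivity
  have e1 : (m : ℝ) ^ k * m ^ (q + 1) = M * m := by rw [hM]; ring
  have e2 : (m : ℝ) ^ ((k : ℝ) * (β - s)) * ((m : ℝ) ^ ((β : ℝ) - s)) ^ q
      = M ^ β * (M ^ s)⁻¹ := by
    rw [Real.rpow_mul hm0.le, Real.rpow_intCast, Real.rpow_pow_comm hm0.le,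
      ← Real.mul_rpow (by positivity) (by positivity), Real.rpow_sub hM0, Real.rpow_natCast,
      div_eq_mul_inv]
  have e3 : (β : ℝ) * √N / 2 + √N = N * √N / 2 := by rw [hNβ]; ring
  have e4 : (N * √N / 2) ^ (β + 2) = N ^ β * N ^ 3 * √N ^ β / (2 ^ β * 4) := by
    rw [div_pow, mul_pow, pow_add (√N), Real.sq_sqrt hN0.le]; ring
  have hs0 : 0 < √N := Real.sqrt_pos.2 hN0
  rw [e1, e3, e4, Real.div_rpow hl.le hM0.le]
  calc _ = unitBallVolume (β + 2) / 4 * (m * N / β) ^ β * N ^ 3 * (M ^ β * (M ^ s)⁻¹) *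
        (l ^ s * (l ^ β)⁻¹) := by
        have hls : 0 < M ^ s := by positivity
        simp only [mul_pow, div_pow]
        field_simp
    _ = _ := by rw [← e2]; ring

/-- The Newtonian potential of point masses on the unit scale `l = m ^ (-k₀)` that satisfy the
Frostman condition up to a sufficiently fine generation. -/
theorem potential_le (hn : 3 ≤ n) (hm : 1 < m) (hs : (n : ℝ) - 2 < s) (k₀ k : ℤ) (d : ℤ) (J : ℕ)
    (hJ : k + J ≤ d) {ι : Type*} [Fintype ι] (y : ι → EuclideanSpace ℝ (Fin n)) (a : ι → ℝ)
    (ha : ∀ i, 0 ≤ a i) (htotal : ∑ i, a i ≤ (1 / (m : ℝ) ^ k₀) ^ s)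
    (hcell : ∀ k' ≤ k₀ + d, ∀ j, ∑ i with cellIndex m k' (y i) = j, a i ≤ (1 / (m : ℝ) ^ k') ^ s)
    (x : EuclideanSpace ℝ (Fin n))
    (hx : ∀ i, ((n : ℝ) - 2) * √n / 2 * (1 / (m : ℝ) ^ (k₀ + k + J)) ≤ dist (y i) x) :
    ∑ i, a i * (dist (y i) x ^ (n - 2))⁻¹ ≤ bourgainTerm n m s k *
      ((1 / (m : ℝ) ^ k₀) ^ s * ((1 / (m : ℝ) ^ k₀) ^ (n - 2))⁻¹) := by
  have hm0 : (0 : ℝ) < m := by positivity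
  have hm1 : (1 : ℝ) < m := by exact_mod_cast hm
  have hn2 : (0 : ℝ) < (n : ℝ) - 2 := by
    have : (3 : ℝ) ≤ n := by exact_mod_cast hn
    linarith
  have hsn : 0 < √(n : ℝ) := Real.sqrt_pos.2 (by linarith)
  set l : ℝ := 1 / (m : ℝ) ^ k₀ with hl
  have hl0 : 0 < l := by positivity
  set ρ : ℝ := ((n : ℝ) - 2) * √n / 2 with hρ
  have hρ0 : 0 < ρ := by positivity
  have hscale : ∀ q : ℕ, 1 / (m : ℝ) ^ (k₀ + k + q) = l / ((m : ℝ) ^ k * m ^ q) := by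
    intro q
    rw [zpow_add₀ hm0.ne', zpow_add₀ hm0.ne', zpow_natCast, hl, div_div, mul_assoc]
  let r : ℕ → ℝ := fun q => ρ * (l / ((m : ℝ) ^ k * m ^ q))
  have hr : ∀ q, 0 < r q := fun q => by positivity
  set x₀ : ℝ := (m : ℝ) ^ ((n : ℝ) - 2 - s)
  have hx0 : 0 < x₀ := by positivity
  have hx1 : x₀ < 1 := Real.rpow_lt_one_of_one_lt_of_neg hm1 (by linarith)
  set C : ℝ := unitBallVolume n / 4 * ((m : ℝ) * n / ((n : ℝ) - 2)) ^ (n - 2) *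
      ((n : ℝ) ^ 3 * (m : ℝ) ^ ((k : ℝ) * ((n : ℝ) - 2 - s))) with hC
  have hvol : 0 ≤ unitBallVolume n := measureReal_nonneg
  have hC0 : 0 ≤ C := by positivity
  have hlβ : 0 ≤ l ^ s * (l ^ (n - 2))⁻¹ := by positivity
  have hsum : ∑ i, a i * (dist (y i) x ^ (n - 2))⁻¹ ≤ (∑ i, a i) * (r 0 ^ (n - 2))⁻¹ +
      ∑ q ∈ Finset.range J, (r (q + 1) ^ (n - 2))⁻¹ * ∑ i with dist (y i) x < r q, a i := by
    calc ∑ i, a i * (dist (y i) x ^ (n - 2))⁻¹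
        ≤ ∑ i, a i * ((r 0 ^ (n - 2))⁻¹ + ∑ q ∈ Finset.range J,
          if dist (y i) x < r q then (r (q + 1) ^ (n - 2))⁻¹ else 0) := by
          refine Finset.sum_le_sum fun i _ => mul_le_mul_of_nonneg_left ?_ (ha i)
          refine inv_pow_le_sum_annuli (n - 2) r hr J ?_
          have := hx i
          rwa [hscale] at this
      _ = _ := by
          simp only [mul_add, Finset.sum_add_distrib, Finset.mul_sum, Finset.sum_mul]
          rw [Finset.sum_comm]
          congr 1
          refine Finset.sum_congr rfl fun q _ => ?_
          rw [Finset.sum_filter]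
          refine Finset.sum_congr rfl fun i _ => ?_
          split_ifs <;> ring
  have hannuli : ∑ q ∈ Finset.range J,
      (r (q + 1) ^ (n - 2))⁻¹ * ∑ i with dist (y i) x < r q, a i ≤
      C / (1 - x₀) * (l ^ s * (l ^ (n - 2))⁻¹) := by
    calc _ ≤ ∑ q ∈ Finset.range J, C * x₀ ^ q * (l ^ s * (l ^ (n - 2))⁻¹) := by
          refine Finset.sum_le_sum fun q hq => ?_
          have hq' := Finset.mem_range.1 hq
          rw [← annulus_constant hn hm k q hl0]
          refine mul_le_mul_of_nonneg_left ?_ (inv_nonneg.2 (pow_nonneg (hr _).le _))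
          have := sum_ball_le (by omega : 0 < m) (k₀ + k + q) y a (by positivity)
            (hcell (k₀ + k + q) (by omega)) ha x hρ0.le
          rwa [hscale] at this
      _ = C * (∑ q ∈ Finset.range J, x₀ ^ q) * (l ^ s * (l ^ (n - 2))⁻¹) := by
          rw [Finset.mul_sum, Finset.sum_mul]
      _ ≤ C * (1 - x₀)⁻¹ * (l ^ s * (l ^ (n - 2))⁻¹) := by
          gcongr
          rw [← tsum_geometric_of_lt_one hx0.le hx1]
          exact (summable_geometric_of_lt_one hx0.le hx1).sum_le_tsum _ fun q _ => by positivity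
      _ = _ := by rw [div_eq_mul_inv]
  have hfirst : (∑ i, a i) * (r 0 ^ (n - 2))⁻¹ ≤
      (2 * (m : ℝ) ^ k / (((n : ℝ) - 2) * √n)) ^ (n - 2) * (l ^ s * (l ^ (n - 2))⁻¹) := by
    calc _ ≤ l ^ s * (r 0 ^ (n - 2))⁻¹ :=
          mul_le_mul_of_nonneg_right htotal (inv_nonneg.2 (pow_nonneg (hr _).le _))
      _ = _ := by
          simp only [r, hρ, pow_zero, mul_one, mul_pow, div_pow]
          field_simp
  calc _ ≤ _ := hsum
    _ ≤ _ := add_le_add hfirst hannuli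
    _ = _ := by rw [bourgainTerm, hC]; ring

theorem bourgainTerm_pos (hn : 3 ≤ n) (hm : 1 < m) (hs : (n : ℝ) - 2 < s) (k : ℤ) :
    0 < bourgainTerm n m s k := by
  have hm1 : (1 : ℝ) < m := by exact_mod_cast hm
  have hn2 : (0 : ℝ) < (n : ℝ) - 2 := by
    have : (3 : ℝ) ≤ n := by exact_mod_cast hn
    linarith
  have hsn : 0 < √(n : ℝ) := Real.sqrt_pos.2 (by linarith)
  have hx1 : 0 < 1 - (m : ℝ) ^ ((n : ℝ) - 2 - s) :=
    sub_pos.2 (Real.rpow_lt_one_of_one_lt_of_neg hm1 (by linarith))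
  have hvol : 0 ≤ unitBallVolume n := measureReal_nonneg
  rw [bourgainTerm]
  positivity

/-- The first summand tends to infinity as `k → ∞`, the second as `k → -∞` because `n - 2 - s < 0`;
a function on `ℤ` with both limits infinite attains its minimum. -/
theorem isLeast_bourgainConst (hn : 3 ≤ n) (hm : 1 < m) (hs : (n : ℝ) - 2 < s) :
    IsLeast (range (bourgainTerm n m s)) (bourgainConst n m s) := by
  have hm0 : (0 : ℝ) < m := by positivity
  have hm1 : (1 : ℝ) < m := by exact_mod_cast hm
  have hn2 : (0 : ℝ) < (n : ℝ) - 2 := by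
    have : (3 : ℝ) ≤ n := by exact_mod_cast hn
    linarith
  have hsn : 0 < √(n : ℝ) := Real.sqrt_pos.2 (by linarith)
  have hx1 : 0 < 1 - (m : ℝ) ^ ((n : ℝ) - 2 - s) :=
    sub_pos.2 (Real.rpow_lt_one_of_one_lt_of_neg hm1 (by linarith))
  have hvol : 0 < unitBallVolume n :=
    ENNReal.toReal_pos (measure_ball_pos _ _ one_pos).ne' measure_ball_lt_top.ne
  have hlow₁ : ∀ k, (2 * (m : ℝ) ^ k / (((n : ℝ) - 2) * √n)) ^ (n - 2) ≤ bourgainTerm n m s k :=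
    fun k => le_add_of_nonneg_right (by positivity)
  have hlow₂ : ∀ k : ℤ, unitBallVolume n / 4 * ((m : ℝ) * n / ((n : ℝ) - 2)) ^ (n - 2)
      * ((n : ℝ) ^ 3 * (m : ℝ) ^ ((k : ℝ) * ((n : ℝ) - 2 - s))
          / (1 - (m : ℝ) ^ ((n : ℝ) - 2 - s))) ≤ bourgainTerm n m s k :=
    fun k => le_add_of_nonneg_left (by positivity)
  have htop : Tendsto (bourgainTerm n m s) atTop atTop := by
    refine tendsto_atTop_mono hlow₁ ((tendsto_pow_atTop (by omega)).comp ?_)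
    refine Tendsto.atTop_div_const (by positivity) (Tendsto.const_mul_atTop two_pos ?_)
    have h := (tendsto_rpow_atTop_of_base_gt_one (m : ℝ) hm1).comp
      (tendsto_intCast_atTop_atTop (R := ℝ))
    simpa [Function.comp_def] using h
  have hbot : Tendsto (bourgainTerm n m s) atBot atTop := by
    refine tendsto_atTop_mono hlow₂ (Tendsto.const_mul_atTop (by positivity)
      (Tendsto.atTop_div_const hx1 (Tendsto.const_mul_atTop (by positivity) ?_)))
    refine (tendsto_rpow_atTop_of_base_gt_one (m : ℝ) hm1).comp ?_
    exact (tendsto_intCast_atBot_iff.2 tendsto_id : Tendsto (fun k : ℤ => (k : ℝ)) atBot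
      atBot).atBot_mul_const_of_neg (by linarith)
  obtain ⟨k, hk⟩ := (continuous_of_discreteTopology (f := bourgainTerm n m s)).exists_forall_le (by
    rw [cocompact_eq_cofinite, Int.cofinite_eq, tendsto_sup]
    exact ⟨hbot, htop⟩)
  have hleast : IsLeast (range (bourgainTerm n m s)) (bourgainTerm n m s k) :=
    ⟨mem_range_self k, forall_mem_range.2 hk⟩
  rwa [bourgainConst, hleast.csInf_eq]

end Potential

/-! ### Subharmonicity of the fundamental solution -/

section Submean

variable {n : ℕ}

/-- `g` satisfies the sub-mean value inequality at `x` up to an error that is small compared with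
the square of the radius. -/
def IsAsympSubmeanAt (g : EuclideanSpace ℝ (Fin n) → ℝ) (x : EuclideanSpace ℝ (Fin n)) : Prop :=
  ∀ η > 0, ∀ᶠ r in 𝓝[>] (0 : ℝ), IntegrableOn (fun z => g (x + z)) (closedBall 0 r) ∧
    -η * ∫ z in closedBall (0 : EuclideanSpace ℝ (Fin n)) r, ‖z‖ ^ 2 ≤
      ∫ z in closedBall (0 : EuclideanSpace ℝ (Fin n)) r, (g (x + z) - g x)

theorem integrableOn_const_closedBall (c r : ℝ) :
    IntegrableOn (fun _ => c) (closedBall (0 : EuclideanSpace ℝ (Fin n)) r) :=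
  integrableOn_const (measure_closedBall_lt_top.ne)

theorem integral_norm_sq_nonneg (r : ℝ) :
    0 ≤ ∫ z in closedBall (0 : EuclideanSpace ℝ (Fin n)) r, ‖z‖ ^ 2 :=
  integral_nonneg fun z => by positivity

theorem IsAsympSubmeanAt.const (c : ℝ) (x : EuclideanSpace ℝ (Fin n)) :
    IsAsympSubmeanAt (fun _ => c) x := by
  intro η hη
  refine Eventually.of_forall fun r => ⟨integrableOn_const_closedBall c r, ?_⟩
  simp only [sub_self, integral_zero]
  nlinarith [integral_norm_sq_nonneg (n := n) r]

theorem IsAsympSubmeanAt.add {g h : EuclideanSpace ℝ (Fin n) → ℝ} {x : EuclideanSpace ℝ (Fin n)}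
    (hg : IsAsympSubmeanAt g x) (hh : IsAsympSubmeanAt h x) :
    IsAsympSubmeanAt (fun x => g x + h x) x := by
  intro η hη
  filter_upwards [hg (η / 2) (half_pos hη), hh (η / 2) (half_pos hη)] with r ⟨h1, h2⟩ ⟨h3, h4⟩
  refine ⟨h1.add h3, ?_⟩
  have e : ∀ z, g (x + z) + h (x + z) - (g x + h x) = (g (x + z) - g x) + (h (x + z) - h x) :=
    fun z => by ring
  simp only [e]
  have h5 : IntegrableOn (fun z => g (x + z) - g x) (closedBall 0 r) :=
    h1.sub (integrableOn_const_closedBall _ r)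
  have h6 : IntegrableOn (fun z => h (x + z) - h x) (closedBall 0 r) :=
    h3.sub (integrableOn_const_closedBall _ r)
  rw [integral_add h5 h6]
  linarith

theorem IsAsympSubmeanAt.const_mul {g : EuclideanSpace ℝ (Fin n) → ℝ}
    {x : EuclideanSpace ℝ (Fin n)} (hg : IsAsympSubmeanAt g x) {c : ℝ} (hc : 0 ≤ c) :
    IsAsympSubmeanAt (fun x => c * g x) x := by
  rcases hc.eq_or_lt with rfl | hc
  · simpa using IsAsympSubmeanAt.const 0 x
  intro η hη
  filter_upwards [hg (η / c) (div_pos hη hc)] with r ⟨h1, h2⟩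
  refine ⟨h1.const_mul c, ?_⟩
  simp only [← mul_sub]
  rw [integral_const_mul]
  have := mul_le_mul_of_nonneg_left h2 hc.le
  refine le_trans (le_of_eq ?_) this
  field_simp

theorem IsAsympSubmeanAt.sum {ι : Type*} (t : Finset ι) {g : ι → EuclideanSpace ℝ (Fin n) → ℝ}
    {x : EuclideanSpace ℝ (Fin n)} (hg : ∀ i, IsAsympSubmeanAt (g i) x) :
    IsAsympSubmeanAt (fun x => ∑ i ∈ t, g i x) x := by
  classical
  induction t using Finset.induction_on with
  | empty => simpa using IsAsympSubmeanAt.const 0 x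
  | insert i t hi ih =>
    simp only [Finset.sum_insert hi]
    exact (hg i).add ih

theorem setIntegral_closedBall_comp_isometry
    (T : EuclideanSpace ℝ (Fin n) ≃ₗᵢ[ℝ] EuclideanSpace ℝ (Fin n))
    (f : EuclideanSpace ℝ (Fin n) → ℝ) (r : ℝ) :
    ∫ z in closedBall 0 r, f (T z) = ∫ z in closedBall 0 r, f z := by
  have h := T.measurePreserving.setIntegral_preimage_emb
    T.toHomeomorph.measurableEmbedding f (closedBall 0 r)
  rwa [T.preimage_closedBall, map_zero] at h

theorem setIntegral_closedBall_of_odd (f : EuclideanSpace ℝ (Fin n) → ℝ) (hf : ∀ z, f (-z) = -f z)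
    (r : ℝ) : ∫ z in closedBall 0 r, f z = 0 := by
  have h := setIntegral_closedBall_comp_isometry (LinearIsometryEquiv.neg ℝ) f r
  simp only [LinearIsometryEquiv.coe_neg, hf, integral_neg] at h
  linarith

/-- By rotation invariance, `z₀` may be replaced by `‖z₀‖` times any basis vector; summing over the
`n` basis vectors produces `‖z‖ ^ 2`. -/
theorem integral_inner_sq (z₀ : EuclideanSpace ℝ (Fin n)) (r : ℝ) :
    n * ∫ z in closedBall (0 : EuclideanSpace ℝ (Fin n)) r, (inner ℝ z₀ z) ^ 2 =
      ‖z₀‖ ^ 2 * ∫ z in closedBall (0 : EuclideanSpace ℝ (Fin n)) r, ‖z‖ ^ 2 := by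
  have key : ∀ i : Fin n, ∫ z in closedBall (0 : EuclideanSpace ℝ (Fin n)) r,
      (inner ℝ z₀ z) ^ 2 = ‖z₀‖ ^ 2 * ∫ z in closedBall (0 : EuclideanSpace ℝ (Fin n)) r,
        (z i) ^ 2 := by
    intro i
    set w : EuclideanSpace ℝ (Fin n) := ‖z₀‖ • EuclideanSpace.single i (1 : ℝ) with hw
    have hnorm : ‖z₀‖ = ‖w‖ := by simp [hw, norm_smul]
    -- The reflection exchanging two vectors of equal norm serves as the rotation.
    set T := (ℝ ∙ (z₀ - w))ᗮ.reflection
    have hT : T z₀ = w := Submodule.reflection_sub hnorm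
    rw [← integral_const_mul, ← setIntegral_closedBall_comp_isometry T
      (fun z => ‖z₀‖ ^ 2 * (z i) ^ 2)]
    refine integral_congr_ae (Eventually.of_forall fun z => ?_)
    have : inner ℝ z₀ z = ‖z₀‖ * (T z) i := by
      rw [← T.inner_map_map, hT, hw, inner_smul_left, EuclideanSpace.inner_single_left]
      simp
    simp only [this, mul_pow]
  have hint : ∀ i : Fin n, IntegrableOn (fun z : EuclideanSpace ℝ (Fin n) => (z i) ^ 2)
      (closedBall 0 r) := fun i =>
    (Continuous.continuousOn (by fun_prop)).integrableOn_compact (isCompact_closedBall 0 r)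
  calc _ = ∑ i : Fin n, ∫ z in closedBall (0 : EuclideanSpace ℝ (Fin n)) r,
      (inner ℝ z₀ z) ^ 2 := by simp
    _ = ∑ i : Fin n, ‖z₀‖ ^ 2 * ∫ z in closedBall (0 : EuclideanSpace ℝ (Fin n)) r,
        (z i) ^ 2 := Finset.sum_congr rfl fun i _ => key i
    _ = _ := by
      rw [← Finset.mul_sum, ← integral_finsetSum _ fun i _ => hint i]
      simp only [EuclideanSpace.real_norm_sq_eq]

/-- The difference of the two sides vanishes to first order at `0` and has second derivative `2 * η
> 0` there, hence a local minimum. -/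
theorem eventually_quadratic_le_one_add_rpow (p : ℝ) {η : ℝ} (hη : 0 < η) :
    ∀ᶠ t in 𝓝 (0 : ℝ), 1 + p * t + (p * (p - 1) / 2 - η) * t ^ 2 ≤ (1 + t) ^ p := by
  set c := p * (p - 1) / 2 - η with hc
  set φ : ℝ → ℝ := fun t => (1 + t) ^ p - (1 + p * t + c * t ^ 2) with hφ
  have hder : ∀ q t : ℝ, -1 < t → HasDerivAt (fun t : ℝ => (1 + t) ^ q) (q * (1 + t) ^ (q - 1)) t := by
    intro q t ht
    have h := ((hasDerivAt_id t).const_add 1).rpow_const (p := q) (Or.inl (by simp; linarith))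
    simpa using h
  have h1 : ∀ t : ℝ, -1 < t → HasDerivAt φ (p * (1 + t) ^ (p - 1) - (p + c * (2 * t))) t := by
    intro t ht
    refine (hder p t ht).sub ?_
    have h2 := (((hasDerivAt_id t).const_mul p).const_add 1).add
      (((hasDerivAt_id t).pow 2).const_mul c)
    convert! h2 using 1
    simp
  have hev : deriv φ =ᶠ[𝓝 0] fun t => p * (1 + t) ^ (p - 1) - (p + c * (2 * t)) := by
    filter_upwards [lt_mem_nhds (show (-1 : ℝ) < 0 by norm_num)] with t ht
    exact (h1 t ht).deriv
  have h2 : HasDerivAt (fun t : ℝ => p * (1 + t) ^ (p - 1) - (p + c * (2 * t)))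
      (p * (p - 1) - c * 2) 0 := by
    have h3 := ((hder (p - 1) 0 (by norm_num)).const_mul p).sub
      ((((hasDerivAt_id (0 : ℝ)).const_mul 2).const_mul c).const_add p)
    convert! h3 using 1
    simp
  have hmin : IsLocalMin φ 0 := by
    refine isLocalMin_of_deriv_deriv_pos ?_ ?_ (h1 0 (by norm_num)).continuousAt
    · rw [hev.deriv_eq, h2.deriv, hc]
      linarith
    · rw [(h1 0 (by norm_num)).deriv]
      simp
  filter_upwards [hmin] with t ht
  simp only [hφ] at ht
  simp at ht
  linarith

theorem integral_quadratic_model (hn : 0 < n) (z₀ : EuclideanSpace ℝ (Fin n))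
    (α β γ κ r : ℝ) :
    ∫ z in closedBall (0 : EuclideanSpace ℝ (Fin n)) r, (α * ‖z‖ ^ 2 + β * inner ℝ z₀ z ^ 2
      + (γ * inner ℝ z₀ z + κ * (inner ℝ z₀ z * ‖z‖ ^ 2))) =
    (α + β * ‖z₀‖ ^ 2 / n) * ∫ z in closedBall (0 : EuclideanSpace ℝ (Fin n)) r, ‖z‖ ^ 2 := by
  have hci : ∀ f : EuclideanSpace ℝ (Fin n) → ℝ, Continuous f →
      IntegrableOn f (closedBall 0 r) :=
    fun f hf => hf.continuousOn.integrableOn_compact (isCompact_closedBall 0 r)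
  have hn0 : (n : ℝ) ≠ 0 := by exact_mod_cast hn.ne'
  rw [integral_add (hci _ (by fun_prop)) (hci _ (by fun_prop)),
    integral_add (hci _ (by fun_prop)) (hci _ (by fun_prop)),
    setIntegral_closedBall_of_odd (fun z => γ * inner ℝ z₀ z + κ * (inner ℝ z₀ z * ‖z‖ ^ 2))
      (fun z => by rw [inner_neg_right, norm_neg]; ring) r,
    integral_const_mul, integral_const_mul]
  have hsq : ∫ z in closedBall (0 : EuclideanSpace ℝ (Fin n)) r, (inner ℝ z₀ z) ^ 2 =
      ‖z₀‖ ^ 2 * (∫ z in closedBall (0 : EuclideanSpace ℝ (Fin n)) r, ‖z‖ ^ 2) / n := by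
    rw [eq_div_iff hn0, mul_comm, integral_inner_sq]
  rw [hsq]
  ring

/-- With `p = -(n - 2) / 2` the kernel is `(‖z₀ + z‖ ^ 2) ^ p = R ^ p * (1 + t) ^ p`. Expanding to
second order in `t` and integrating, odd terms vanish and the coefficient of `∫ ‖z‖ ^ 2` is a
multiple of `p + 4 * q / n`. This is zero for exactly this exponent, which is the harmonicity of the
kernel. -/
theorem isAsympSubmeanAt_fundamental (hn : 3 ≤ n) {x y : EuclideanSpace ℝ (Fin n)} (hxy : x ≠ y) :
    IsAsympSubmeanAt (fun x => (dist y x ^ (n - 2))⁻¹) x := by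
  intro η hη
  set z₀ := x - y with hz₀
  have hρ : 0 < ‖z₀‖ := norm_pos_iff.2 (sub_ne_zero.2 hxy)
  set ρ := ‖z₀‖ with hρdef
  set R := ρ ^ 2 with hR
  have hR0 : 0 < R := by positivity
  have hn0 : (0 : ℝ) < n := by exact_mod_cast (by omega : 0 < n)
  have hn2 : ((n - 2 : ℕ) : ℝ) = n - 2 := by rw [Nat.cast_sub (by omega)]; simp
  set p : ℝ := -(((n - 2 : ℕ) : ℝ) / 2) with hp
  set q : ℝ := p * (p - 1) / 2 with hq
  have hp0 : p ≤ 0 := by rw [hp]; simp; positivity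
  have hq0 : 0 ≤ q := by rw [hq]; nlinarith
  have hpq : p + 4 * q / n = 0 := by
    rw [hq, hp, hn2]; field_simp; ring
  have hker : ∀ z, (dist y (x + z) ^ (n - 2))⁻¹ = (‖z₀ + z‖ ^ 2) ^ p := by
    intro z
    have : dist y (x + z) = ‖z₀ + z‖ := by
      rw [dist_eq_norm', hz₀]; congr 1; abel
    rw [this, hp, Real.rpow_neg (by positivity), ← Real.rpow_natCast ‖z₀ + z‖ 2,
      ← Real.rpow_mul (norm_nonneg _), ← Real.rpow_natCast]
    congr 2
    push_cast; ring
  set t : EuclideanSpace ℝ (Fin n) → ℝ := fun z => (2 * inner ℝ z₀ z + ‖z‖ ^ 2) / R with ht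
  have hexp : ∀ z, ‖z₀ + z‖ ^ 2 = R * (1 + t z) := by
    intro z
    rw [norm_add_sq_real, ht, mul_add, mul_div_cancel₀ _ hR0.ne']
    ring
  have hRp : 0 < R ^ p := by positivity
  -- Chosen so that, by `|R * t z| ≤ (2 * ρ + 1) * ‖z‖`, the Taylor error `R ^ p * η' * t z ^ 2` is
  -- at most `η * ‖z‖ ^ 2`.
  set η' : ℝ := η * R ^ 2 / (R ^ p * (2 * ρ + 1) ^ 2) with hη'
  have hη'0 : 0 < η' := by positivity
  have ht0 : Tendsto t (𝓝 0) (𝓝 0) := by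
    have : Continuous t := by fun_prop
    simpa [ht] using this.tendsto 0
  obtain ⟨ε, hε, hball⟩ := Metric.eventually_nhds_iff_ball.1
    (ht0.eventually (eventually_quadratic_le_one_add_rpow p hη'0))
  have hsmall : ∀ᶠ r in 𝓝[>] (0 : ℝ), r < ε ∧ r < ρ ∧ r < 1 :=
    eventually_nhdsWithin_of_eventually_nhds ((gt_mem_nhds hε).and
      ((gt_mem_nhds hρ).and (gt_mem_nhds one_pos)))
  filter_upwards [hsmall] with r ⟨hrε, hrρ, hr1⟩
  set B := closedBall (0 : EuclideanSpace ℝ (Fin n)) r with hB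
  have hBc : IsCompact B := isCompact_closedBall 0 r
  have hint : IntegrableOn (fun z => (dist y (x + z) ^ (n - 2))⁻¹) B := by
    refine ContinuousOn.integrableOn_compact hBc (ContinuousOn.inv₀ (by fun_prop) fun z hz => ?_)
    refine pow_ne_zero _ (dist_ne_zero.2 fun h => ?_)
    have h3 : z₀ = -z := by rw [hz₀, h]; abel
    have h4 := mem_closedBall_zero_iff.1 hz
    rw [hρdef, h3, norm_neg] at hrρ
    linarith
  have hci : ∀ f : EuclideanSpace ℝ (Fin n) → ℝ, Continuous f → IntegrableOn f B :=
    fun f hf => hf.continuousOn.integrableOn_compact hBc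
  refine ⟨hint, ?_⟩
  have hpt : ∀ z ∈ B, (R ^ p * (p / R) - η) * ‖z‖ ^ 2 + R ^ p * (4 * q / R ^ 2) * inner ℝ z₀ z ^ 2
      + (R ^ p * (2 * p / R) * inner ℝ z₀ z
        + R ^ p * (4 * q / R ^ 2) * (inner ℝ z₀ z * ‖z‖ ^ 2)) ≤
      (dist y (x + z) ^ (n - 2))⁻¹ - (dist y x ^ (n - 2))⁻¹ := by
    intro z hz
    have hzr := mem_closedBall_zero_iff.1 hz
    have h0 := hker 0
    rw [add_zero, add_zero] at h0
    have h1 := hball z (by rw [mem_ball_zero_iff]; linarith)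
    have h1t : 0 ≤ 1 + t z := by
      have := sq_nonneg ‖z₀ + z‖
      rw [hexp] at this
      exact nonneg_of_mul_nonneg_right this hR0
    rw [hker z, hexp, h0, Real.mul_rpow hR0.le h1t]
    have e : R * t z = 2 * inner ℝ z₀ z + ‖z‖ ^ 2 := mul_div_cancel₀ _ hR0.ne'
    have htz : |R * t z| ≤ (2 * ρ + 1) * ‖z‖ := by
      have h2 : |inner ℝ z₀ z| ≤ ρ * ‖z‖ := abs_real_inner_le_norm z₀ z
      have h3 : 0 ≤ ‖z‖ := norm_nonneg z
      have h4 : ‖z‖ ^ 2 ≤ ‖z‖ := by nlinarith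
      rw [e]
      calc |2 * inner ℝ z₀ z + ‖z‖ ^ 2| ≤ |2 * inner ℝ z₀ z| + |‖z‖ ^ 2| := abs_add_le _ _
        _ = 2 * |inner ℝ z₀ z| + ‖z‖ ^ 2 := by
          rw [abs_mul, abs_two, abs_of_nonneg (sq_nonneg ‖z‖)]
        _ ≤ _ := by linarith
    have htz2 : t z ^ 2 * R ^ 2 ≤ (2 * ρ + 1) ^ 2 * ‖z‖ ^ 2 := by
      rw [← mul_pow, ← mul_pow, mul_comm (t z), ← sq_abs]
      exact pow_le_pow_left₀ (abs_nonneg _) htz 2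
    have herr : R ^ p * (η' * t z ^ 2) ≤ η * ‖z‖ ^ 2 := by
      rw [hη']
      calc _ = η * (t z ^ 2 * R ^ 2) / (2 * ρ + 1) ^ 2 := by field_simp
        _ ≤ η * ((2 * ρ + 1) ^ 2 * ‖z‖ ^ 2) / (2 * ρ + 1) ^ 2 := by gcongr
        _ = _ := by field_simp
    have hmain : R ^ p * (p / R) * ‖z‖ ^ 2 + R ^ p * (4 * q / R ^ 2) * inner ℝ z₀ z ^ 2
        + (R ^ p * (2 * p / R) * inner ℝ z₀ z
        + R ^ p * (4 * q / R ^ 2) * (inner ℝ z₀ z * ‖z‖ ^ 2)) ≤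
        R ^ p * (p * t z + q * t z ^ 2) := by
      have e2 : R ^ p * (p * t z + q * t z ^ 2) =
        (R ^ p * (p / R) * ‖z‖ ^ 2 + R ^ p * (4 * q / R ^ 2) * inner ℝ z₀ z ^ 2
        + (R ^ p * (2 * p / R) * inner ℝ z₀ z
        + R ^ p * (4 * q / R ^ 2) * (inner ℝ z₀ z * ‖z‖ ^ 2))) +
          R ^ p * (q * (‖z‖ ^ 2) ^ 2 / R ^ 2) := by
        have e3 : t z = (2 * inner ℝ z₀ z + ‖z‖ ^ 2) / R := rfl
        rw [e3]
        field_simp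
        ring
      -- The quartic term of the expansion is nonnegative since `q ≥ 0`, so it can be dropped from a
      -- lower bound.
      have : 0 ≤ R ^ p * (q * (‖z‖ ^ 2) ^ 2 / R ^ 2) := by positivity
      linarith
    have h5 := mul_le_mul_of_nonneg_left h1 hRp.le
    have e4 : R ^ p * (1 + p * t z + (q - η') * t z ^ 2) =
      R ^ p + R ^ p * (p * t z + q * t z ^ 2) - R ^ p * (η' * t z ^ 2) := by ring
    rw [e4] at h5
    linarith
  have hmono := setIntegral_mono_on (μ := volume) (s := B) (hci _ (by fun_prop))
    (hint.sub (integrableOn_const_closedBall _ r)) measurableSet_closedBall hpt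
  rw [integral_quadratic_model (by omega)] at hmono
  refine le_trans (le_of_eq ?_) hmono
  congr 1
  have e : R ^ p * (p / R) - η + R ^ p * (4 * q / R ^ 2) * R / n =
      R ^ p / R * (p + 4 * q / n) - η := by
    field_simp
    ring
  rw [e, hpq]
  ring

end Submean

/-! ### Minimum principle and comparison with the Perron class -/

section Perron

variable {n : ℕ}

theorem integral_norm_sq_pos (hn : 0 < n) {r : ℝ} (hr : 0 < r) :
    0 < ∫ z in closedBall (0 : EuclideanSpace ℝ (Fin n)) r, ‖z‖ ^ 2 := by
  have hint : IntegrableOn (fun z : EuclideanSpace ℝ (Fin n) => ‖z‖ ^ 2) (closedBall 0 r) :=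
    (Continuous.continuousOn (by fun_prop)).integrableOn_compact (isCompact_closedBall 0 r)
  rw [setIntegral_pos_iff_support_of_nonneg_ae (Eventually.of_forall fun z => by
    simp only [Pi.zero_apply]; positivity) hint]
  have hopen : IsOpen ({z : EuclideanSpace ℝ (Fin n) | z ≠ 0} ∩ ball 0 r) :=
    isOpen_ne.inter isOpen_ball
  have hne : ({z : EuclideanSpace ℝ (Fin n) | z ≠ 0} ∩ ball 0 r).Nonempty := by
    have hnorm : ‖EuclideanSpace.single (⟨0, hn⟩ : Fin n) (r / 2)‖ = r / 2 := by
      simp [abs_of_pos hr]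
    refine ⟨EuclideanSpace.single ⟨0, hn⟩ (r / 2), ?_, ?_⟩
    · exact norm_pos_iff.1 (by rw [hnorm]; linarith)
    · rw [mem_ball_zero_iff, hnorm]; linarith
  refine (hopen.measure_pos volume hne).trans_le (measure_mono fun z hz => ⟨?_, ?_⟩)
  · exact pow_ne_zero _ (norm_ne_zero_iff.2 hz.1)
  · exact ball_subset_closedBall hz.2

theorem IsSuperharmonicOn.integral_sub_le {v : EuclideanSpace ℝ (Fin n) → ℝ}
    {Ω : Set (EuclideanSpace ℝ (Fin n))} (hv : IsSuperharmonicOn v Ω)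
    {x : EuclideanSpace ℝ (Fin n)} {r : ℝ} (hr : 0 < r) (hxr : closedBall x r ⊆ Ω) :
    IntegrableOn (fun z => v (x + z)) (closedBall 0 r) ∧
      ∫ z in closedBall 0 r, (v (x + z) - v x) ≤ 0 := by
  have hmp := measurePreserving_add_left (volume : Measure (EuclideanSpace ℝ (Fin n))) x
  have hemb := (Homeomorph.addLeft x).measurableEmbedding
  have hpre : (fun z => x + z) ⁻¹' closedBall x r = closedBall 0 r := by
    simp [preimage_add_closedBall]
  have hint : IntegrableOn (fun z => v (x + z)) (closedBall 0 r) := by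
    have := (hmp.integrableOn_comp_preimage hemb (f := v) (s := closedBall x r)).2
      (hv.integrableOn x r hr hxr)
    rwa [hpre] at this
  refine ⟨hint, ?_⟩
  have hI : ∫ z in closedBall 0 r, v (x + z) = ∫ y in closedBall x r, v y := by
    have := hmp.setIntegral_preimage_emb hemb v (closedBall x r)
    rwa [hpre] at this
  have hvol : 0 < volume.real (closedBall x r) :=
    ENNReal.toReal_pos (measure_closedBall_pos _ _ hr).ne' measure_closedBall_lt_top.ne
  have havg := hv.average_le x r hr hxr
  rw [setAverage_eq, smul_eq_mul, inv_mul_le_iff₀ hvol] at havg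
  rw [integral_sub hint (integrableOn_const_closedBall _ r), hI, setIntegral_const, smul_eq_mul,
    ← Measure.addHaar_real_closedBall_center volume x r]
  linarith

/-- Minimum principle for `v - g`, with `v` superharmonic and `g` asymptotically submean. -/
theorem IsSuperharmonicOn.ge_of_frontier (hn : 0 < n) {v g : EuclideanSpace ℝ (Fin n) → ℝ}
    {Ω : Set (EuclideanSpace ℝ (Fin n))} (hΩ : IsOpen Ω) (hb : Bornology.IsBounded Ω)
    (hv : IsSuperharmonicOn v Ω) (hg : ContinuousOn g Ω) (hsub : ∀ x ∈ Ω, IsAsympSubmeanAt g x)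
    (hfr : ∀ ζ ∈ frontier Ω, ∀ c < 0, ∀ᶠ x in 𝓝[Ω] ζ, c < v x - g x)
    {X : EuclideanSpace ℝ (Fin n)} (hX : X ∈ Ω) : g X ≤ v X := by
  by_contra! hlt
  obtain ⟨R, hR0, hR⟩ := hb.exists_pos_norm_le
  set c₀ := v X - g X with hc₀
  have hc0 : c₀ < 0 := by linarith
  set ε := -c₀ / (2 * R ^ 2) with hε
  have hε0 : 0 < ε := div_pos (by linarith) (by positivity)
  have hεR : ε * R ^ 2 = -c₀ / 2 := by rw [hε]; field_simp
  -- Subtracting `ε * ‖x‖ ^ 2` costs at most `-c₀ / 2` on the domain, so `w` still has an interior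
  -- minimum. There the mean value inequalities give `ε * ∫ ‖z‖ ^ 2 ≤ ε / 2 * ∫ ‖z‖ ^ 2`, which is
  -- absurd.
  set w : EuclideanSpace ℝ (Fin n) → ℝ := fun x => v x + (-(g x) - ε * ‖x‖ ^ 2) with hw
  have hwlsc : LowerSemicontinuousOn w Ω :=
    hv.lsc.add (hg.neg.sub (by fun_prop)).lowerSemicontinuousOn
  have hwX : w X ≤ c₀ := by
    have : 0 ≤ ε * ‖X‖ ^ 2 := by positivity
    simp only [hw]; linarith
  have hbdry : ∀ ζ ∈ closure Ω, ζ ∉ Ω → ∀ᶠ x in 𝓝[Ω] ζ, w X < w x := by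
    intro ζ hζ hζΩ
    filter_upwards [hfr ζ ⟨hζ, by rwa [hΩ.interior_eq]⟩ (c₀ / 2) (by linarith),
      self_mem_nhdsWithin] with x hx hxΩ
    have : ε * ‖x‖ ^ 2 ≤ ε * R ^ 2 := by gcongr; exact hR x hxΩ
    simp only [hw] at hwX ⊢
    linarith
  set K := {x ∈ Ω | w x ≤ w X} with hK
  have hKΩ : K ⊆ Ω := fun x hx => hx.1
  have hKclosed : IsClosed K := by
    refine isClosed_of_closure_subset fun ζ hζ => ?_
    have hfreq : ∃ᶠ x in 𝓝[Ω] ζ, w x ≤ w X := by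
      rw [frequently_nhdsWithin_iff]
      exact (mem_closure_iff_frequently.1 hζ).mono fun x hx => ⟨hx.2, hx.1⟩
    by_contra hnot
    have hev : ∀ᶠ x in 𝓝[Ω] ζ, w X < w x := by
      by_cases hζΩ : ζ ∈ Ω
      · exact hwlsc ζ hζΩ _ (lt_of_not_ge fun h => hnot ⟨hζΩ, h⟩)
      · exact hbdry ζ (closure_mono hKΩ hζ) hζΩ
    exact hfreq (hev.mono fun x hx => not_le.2 hx)
  have hKc : IsCompact K := isCompact_of_isClosed_isBounded hKclosed (hb.subset hKΩ)
  obtain ⟨x₀, hx₀, hmin⟩ := LowerSemicontinuousOn.exists_isMinOn (⟨X, hX, le_rfl⟩ : K.Nonempty) hKc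
    (hwlsc.mono hKΩ)
  have hmin' : ∀ x ∈ Ω, w x₀ ≤ w x := by
    intro x hx
    by_cases h : w x ≤ w X
    · exact hmin ⟨hx, h⟩
    · exact hx₀.2.trans (not_le.1 h).le
  have hball : ∀ᶠ r in 𝓝[>] (0 : ℝ), closedBall x₀ r ⊆ Ω := by
    obtain ⟨ρ, hρ, hρΩ⟩ := Metric.isOpen_iff.1 hΩ x₀ hx₀.1
    filter_upwards [eventually_nhdsWithin_of_eventually_nhds (gt_mem_nhds hρ)] with r hr
    exact (closedBall_subset_ball hr).trans hρΩ
  obtain ⟨r, ⟨hrΩ, hgint, hgr⟩, hr0⟩ := ((hball.and (hsub x₀ hx₀.1 (ε / 2) (half_pos hε0))).and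
    self_mem_nhdsWithin).exists
  have hr0 : 0 < r := hr0
  obtain ⟨hvint, hvr⟩ := hv.integral_sub_le hr0 hrΩ
  have hA := integral_norm_sq_pos hn hr0
  have hci : ∀ f : EuclideanSpace ℝ (Fin n) → ℝ, Continuous f →
      IntegrableOn f (closedBall 0 r) :=
    fun f hf => hf.continuousOn.integrableOn_compact (isCompact_closedBall 0 r)
  have hgint' : IntegrableOn (fun z => g (x₀ + z) - g x₀) (closedBall 0 r) :=
    hgint.sub (integrableOn_const_closedBall _ r)
  have hvint' : IntegrableOn (fun z => v (x₀ + z) - v x₀) (closedBall 0 r) :=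
    hvint.sub (integrableOn_const_closedBall _ r)
  have hqint : IntegrableOn (fun z : EuclideanSpace ℝ (Fin n) =>
      ε * ‖z‖ ^ 2 + 2 * ε * inner ℝ x₀ z) (closedBall 0 r) := hci _ (by fun_prop)
  have hmono := setIntegral_mono_on (hgint'.add hqint) hvint' measurableSet_closedBall
    (fun z hz => by
      have h1 := hmin' (x₀ + z) (hrΩ (by simpa using hz))
      have h2 := norm_add_sq_real x₀ z
      simp only [hw] at h1
      simp only [Pi.add_apply]
      rw [h2] at h1
      linarith)
  have hsplit : ∫ z in closedBall (0 : EuclideanSpace ℝ (Fin n)) r,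
      ((g (x₀ + z) - g x₀) + (ε * ‖z‖ ^ 2 + 2 * ε * inner ℝ x₀ z)) =
      (∫ z in closedBall 0 r, (g (x₀ + z) - g x₀)) +
        ε * ∫ z in closedBall (0 : EuclideanSpace ℝ (Fin n)) r, ‖z‖ ^ 2 := by
    rw [integral_add hgint' hqint, integral_add (hci _ (by fun_prop)) (hci _ (by fun_prop)),
      setIntegral_closedBall_of_odd (fun z => 2 * ε * inner ℝ x₀ z)
        (fun z => by rw [inner_neg_right]; ring), integral_const_mul, add_zero]
  have hle := hsplit.symm.trans_le hmono
  have : 0 < ε / 2 * ∫ z in closedBall (0 : EuclideanSpace ℝ (Fin n)) r, ‖z‖ ^ 2 := by positivity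
  linarith

theorem IsSuperharmonicOn.mono {v : EuclideanSpace ℝ (Fin n) → ℝ}
    {Ω Ω' : Set (EuclideanSpace ℝ (Fin n))} (hv : IsSuperharmonicOn v Ω) (h : Ω' ⊆ Ω) :
    IsSuperharmonicOn v Ω' :=
  ⟨hv.lsc.mono h, fun x r hr hx => hv.integrableOn x r hr (hx.trans h),
    fun x r hr hx => hv.average_le x r hr (hx.trans h)⟩

/-- Comparison of a function of the upper Perron class of `E ∩ Q` with functions that are only
controlled away from a compact subset of `E ∩ Q`. -/
theorem exists_thickening_comparison (hn : 0 < n) {Q E F : Set (EuclideanSpace ℝ (Fin n))}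
    (hQ : IsOpen Q) (hQb : Bornology.IsBounded Q) (hE : IsClosed E) (hF : IsCompact F)
    (hFE : F ⊆ E ∩ Q) {v : EuclideanSpace ℝ (Fin n) → ℝ}
    (hv : v ∈ upperPerronClass (Q \ E) ((E ∩ Q).indicator fun _ => 1))
    {X : EuclideanSpace ℝ (Fin n)} (hX : X ∈ Q \ E) {ε : ℝ} (hε : 0 < ε) :
    ∃ δ > 0, ∀ g : EuclideanSpace ℝ (Fin n) → ℝ, (∀ x ∉ F, ContinuousAt g x) →
      (∀ x ∉ F, IsAsympSubmeanAt g x) → (∀ x ∉ Q, g x ≤ 0) →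
      (∀ x ∉ thickening δ F, g x ≤ 1) → g X ≤ v X + ε := by
  obtain ⟨hsup, -, hbd⟩ := hv
  set Ω := Q \ E with hΩdef
  have hΩ : IsOpen Ω := hQ.sdiff hE
  -- An open set near whose points `v > 1 - ε` inside the domain. It contains `F`: the boundary
  -- value is `1` at points of `F` on the frontier, and the condition is vacuous off the closure of
  -- the domain.
  set V := {x | ∀ᶠ y in 𝓝 x, y ∈ Ω → 1 - ε < v y} with hV
  have hVo : IsOpen V := isOpen_setOfPred_eventually_nhds
  have hFV : F ⊆ V ∩ {X}ᶜ := by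
    intro x hx
    refine ⟨?_, fun h => hX.2 ((mem_singleton_iff.1 h) ▸ (hFE hx).1)⟩
    change ∀ᶠ y in 𝓝 x, y ∈ Ω → 1 - ε < v y
    rw [← eventually_nhdsWithin_iff]
    by_cases hcl : x ∈ closure Ω
    · refine hbd x ⟨hcl, ?_⟩ (1 - ε) ?_
      · rw [hΩ.interior_eq]
        exact fun h => h.2 (hFE hx).1
      · rw [indicator_of_mem (hFE hx)]
        linarith
    · rw [notMem_closure_iff_nhdsWithin_eq_bot.1 hcl]
      exact eventually_bot
  obtain ⟨δ, hδ, hδV⟩ := hF.exists_cthickening_subset_open (hVo.inter isOpen_compl_singleton) hFV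
  refine ⟨δ, hδ, fun g hgc hgs hg0 hg1 => ?_⟩
  -- A frontier point of `Ω'` lies in `V`, where `v > 1 - ε`, or on the frontier of `Ω`. In the
  -- latter case it is in `E ∩ Q`, with boundary value `1`, or off `Q`, where `g ≤ 0`. Lowering `g`
  -- by `ε` covers all cases.
  set Ω' := Ω \ cthickening δ F with hΩ'
  have hΩ'o : IsOpen Ω' := hΩ.sdiff isClosed_cthickening
  have hsubΩ : Ω' ⊆ Ω := sdiff_subset
  have hnotF : ∀ x ∈ Ω', x ∉ F := fun x hx hxF => hx.1.2 (hFE hxF).1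
  have key : g X + (-ε) ≤ v X := by
    refine IsSuperharmonicOn.ge_of_frontier hn (g := fun x => g x + (-ε)) hΩ'o
      (hQb.subset (hsubΩ.trans sdiff_subset)) (hsup.mono hsubΩ)
      (fun x hx => ((hgc x (hnotF x hx)).add continuousAt_const).continuousWithinAt)
      (fun x hx => (hgs x (hnotF x hx)).add (IsAsympSubmeanAt.const _ _)) ?_
      ⟨hX, fun h => (hδV h).2 rfl⟩
    rintro ζ ⟨hζcl, hζint⟩ c hc
    rw [hΩ'o.interior_eq] at hζint
    have hζthick : ζ ∉ thickening δ F := by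
      have hsub : Ω' ⊆ (thickening δ F)ᶜ := fun x hx h =>
        hx.2 (thickening_subset_cthickening δ F h)
      exact closure_minimal hsub isOpen_thickening.isClosed_compl hζcl
    have hζF : ζ ∉ F := fun h => hζthick (self_subset_thickening hδ F h)
    have hmono : 𝓝[Ω'] ζ ≤ 𝓝[Ω] ζ := nhdsWithin_mono _ hsubΩ
    have hgev : ∀ b, g ζ < b → ∀ᶠ x in 𝓝[Ω'] ζ, g x < b := fun b hb =>
      eventually_nhdsWithin_of_eventually_nhds ((hgc ζ hζF).eventually (gt_mem_nhds hb))
    by_cases hζΩ : ζ ∈ Ω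
    · have hζV : ζ ∈ V := by
        by_contra h
        exact hζint ⟨hζΩ, fun h' => h (hδV h').1⟩
      have h1 : ∀ᶠ x in 𝓝[Ω'] ζ, 1 - ε < v x :=
        hmono (eventually_nhdsWithin_iff.2 hζV)
      filter_upwards [h1, hgev (1 - c) (by linarith [hg1 ζ hζthick])] with x hx1 hx2
      linarith
    · have hζfr : ζ ∈ frontier Ω :=
        ⟨closure_mono hsubΩ hζcl, by rwa [hΩ.interior_eq]⟩
      by_cases hζQ : ζ ∈ Q
      · have hζE : ζ ∈ E ∩ Q := ⟨by_contra fun h => hζΩ ⟨hζQ, h⟩, hζQ⟩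
        have h1 : ∀ᶠ x in 𝓝[Ω'] ζ, 1 + c < v x :=
          hmono (hbd ζ hζfr _ (by rw [indicator_of_mem hζE]; linarith))
        filter_upwards [h1, hgev (1 + ε) (by linarith [hg1 ζ hζthick])] with x hx1 hx2
        linarith
      · have h1 : ∀ᶠ x in 𝓝[Ω'] ζ, c < v x :=
          hmono (hbd ζ hζfr _ (by rw [indicator_of_notMem fun h => hζQ h.2]; exact hc))
        filter_upwards [h1, hgev ε (by linarith [hg0 ζ hζQ])] with x hx1 hx2
        linarith
  linarith

theorem upperPerronClass_indicator_nonempty (Ω A : Set (EuclideanSpace ℝ (Fin n))) :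
    (upperPerronClass Ω (A.indicator fun _ => (1 : ℝ))).Nonempty := by
  refine ⟨fun _ => 1, ⟨lowerSemicontinuousOn_const, fun x r _ _ => integrableOn_const
    measure_closedBall_lt_top.ne, fun x r hr _ => ?_⟩, ⟨1, ?_⟩, fun ζ _ c hc => ?_⟩
  · exact (setAverage_const (measure_closedBall_pos _ _ hr).ne' measure_closedBall_lt_top.ne
      (1 : ℝ)).le
  · rintro _ ⟨x, _, rfl⟩
    exact le_rfl
  · exact Eventually.of_forall fun x => hc.trans_le (indicator_le_self' (fun _ _ => zero_le_one) ζ)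

end Perron

/-! ### Position of the small cube in the large one -/

section Geometry

variable {n m : ℕ}

/-- In units of the small side, the corner of `P` is an integer vector `p` and its center is `p + m
/ 2`, which must lie in `[j, j + 1]` coordinatewise. For odd `m` this forces the small cube to be
central; for even `m` the center is a grid point and the small cube may be on either side of it, so
one side loses half a unit of margin. -/
theorem aligned_cube_margins (hm : 0 < m) {P Pstar : HalfOpenCube n} (hP : P ∈ alignedGrid n m)
    (hPstar : Pstar ∈ madicGrid n m) (hside : Pstar.side = (m : ℝ)⁻¹ * P.side)
    (hcenter : P.center ∈ closure Pstar.toSet) :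
    ∃ (k₀ : ℤ) (j p : Fin n → ℤ), Pstar = gridCube n m k₀ j ∧
      (∀ i, P.corner i = p i * (1 / (m : ℝ) ^ k₀)) ∧ P.side = m * (1 / (m : ℝ) ^ k₀) ∧
      ∀ i, (p i : ℝ) + (m - xi m) / 2 ≤ j i ∧ (j i : ℝ) + 1 + (m - xi m) / 2 ≤ p i + m := by
  have hm0 : (0 : ℝ) < m := by exact_mod_cast hm
  obtain ⟨P₀, ⟨k, jP, rfl⟩, j', rfl⟩ := hP
  obtain ⟨k₀, j, rfl⟩ := hPstar
  have hk : (0 : ℝ) < (m : ℝ) ^ k₀ := zpow_pos hm0 k₀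
  set l : ℝ := 1 / (m : ℝ) ^ k₀ with hl
  have hlk : l * (m : ℝ) ^ k₀ = 1 := by rw [hl]; field_simp
  have hside' : 1 / (m : ℝ) ^ k = m * l := by
    simp only [HalfOpenCube.translate] at hside
    rw [hside]
    field_simp
  have hcorner : ∀ i, (jP i : ℝ) / (m : ℝ) ^ k + (m : ℝ)⁻¹ * (1 / (m : ℝ) ^ k) * j' i =
      ((m * jP i + j' i : ℤ) : ℝ) * l := by
    intro i
    rw [div_eq_mul_one_div, hside']
    push_cast
    field_simp
  refine ⟨k₀, j, fun i => m * jP i + j' i, rfl, hcorner, hside', fun i => ?_⟩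
  have hc := closure_gridCube_subset hm k₀ j hcenter i
  have hci : (HalfOpenCube.translate (⟨WithLp.toLp 2 fun i => (jP i : ℝ) / (m : ℝ) ^ k,
      1 / (m : ℝ) ^ k⟩ : HalfOpenCube n) (WithLp.toLp 2 fun i => (m : ℝ)⁻¹ *
        (1 / (m : ℝ) ^ k) * (j' i : ℝ))).center i =
      ((m * jP i + j' i : ℤ) : ℝ) * l + m * l / 2 := by
    rw [← hcorner, ← hside']
    rfl
  rw [hci] at hc
  have hc' : (((m * jP i + j' i : ℤ) : ℝ) * l + m * l / 2) * (m : ℝ) ^ k₀ =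
      ((m * jP i + j' i : ℤ) : ℝ) + m / 2 := by
    linear_combination (((m * jP i + j' i : ℤ) : ℝ) + m / 2) * hlk
  rw [hc'] at hc
  beta_reduce
  generalize (m : ℤ) * jP i + j' i = q at hc ⊢
  have h1 : 2 * j i ≤ 2 * q + m := by
    have := hc.1
    rify
    linarith
  have h2 : 2 * q + m ≤ 2 * j i + 2 := by
    have := hc.2
    rify
    linarith
  rw [xi]
  split_ifs with hodd
  · obtain ⟨t, rfl⟩ := hodd
    have h3 : q + t ≤ j i := by push_cast at h1 h2; omega
    have h4 : j i + 1 + t ≤ q + (2 * t + 1) := by push_cast at h1 h2; omega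
    rify at h3 h4
    push_cast
    constructor <;> linarith
  · obtain ⟨t, rfl⟩ := Nat.not_odd_iff_even.1 hodd
    have h3 : q + (t - 1) ≤ j i := by push_cast at h1 h2; omega
    have h4 : j i + 1 + (t - 1) ≤ q + 2 * t := by push_cast at h1 h2; omega
    rify at h3 h4
    push_cast
    constructor <;> linarith

theorem mem_interior_of_forall_lt (P : HalfOpenCube n) {x : EuclideanSpace ℝ (Fin n)}
    (hx : ∀ i, P.corner i < x i ∧ x i < P.corner i + P.side) : x ∈ interior P.toSet := by
  have hopen : IsOpen {x : EuclideanSpace ℝ (Fin n) |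
      ∀ i, P.corner i < x i ∧ x i < P.corner i + P.side} := by
    simp only [Set.ofPred_forall, Set.ofPred_and]
    exact isOpen_iInter_of_finite fun i => (isOpen_lt continuous_const (by fun_prop)).inter
      (isOpen_lt (by fun_prop) continuous_const)
  exact interior_maximal (fun y hy i => ⟨(hy i).1.le, (hy i).2⟩) hopen hx

theorem isBounded_cube (P : HalfOpenCube n) : Bornology.IsBounded P.toSet := by
  rcases le_or_gt 0 P.side with h | h
  · refine (isBounded_closedBall (x := P.corner) (r := √n * P.side)).subset fun x hx => ?_
    refine mem_closedBall.2 (dist_le_sqrt_mul h fun i => ?_)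
    have := hx i
    rw [abs_le]
    constructor <;> linarith
  · rcases isEmpty_or_nonempty (Fin n) with _ | ⟨⟨i⟩⟩
    · exact (Set.toFinite _).isBounded
    · have : P.toSet = ∅ := eq_empty_of_forall_notMem fun x hx => by
        have := hx i
        linarith
      rw [this]
      exact Bornology.isBounded_empty

theorem abs_coord_sub_le_dist (x y : EuclideanSpace ℝ (Fin n)) (i : Fin n) :
    |x i - y i| ≤ dist x y := by
  rw [dist_eq_norm]
  exact PiLp.norm_apply_le (x - y) i

/-- A point outside the large cube is at distance at least `c * l` from the small one. -/
theorem mul_le_dist_of_notMem_interior (hm : 0 < m) {P : HalfOpenCube n} {k₀ : ℤ}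
    {j p : Fin n → ℤ} {c : ℝ} (hcorner : ∀ i, P.corner i = p i * (1 / (m : ℝ) ^ k₀))
    (hPside : P.side = m * (1 / (m : ℝ) ^ k₀))
    (hmargin : ∀ i, (p i : ℝ) + c ≤ j i ∧ (j i : ℝ) + 1 + c ≤ p i + m)
    {y ζ : EuclideanSpace ℝ (Fin n)} (hy : y ∈ closure (gridCube n m k₀ j).toSet)
    (hζ : ζ ∉ interior P.toSet) : c * (1 / (m : ℝ) ^ k₀) ≤ dist y ζ := by
  have hm0 : (0 : ℝ) < m := by exact_mod_cast hm
  have hk : (0 : ℝ) < (m : ℝ) ^ k₀ := zpow_pos hm0 k₀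
  set l : ℝ := 1 / (m : ℝ) ^ k₀ with hl
  have hl0 : 0 < l := by positivity
  obtain ⟨i, hi⟩ : ∃ i, ¬ (P.corner i < ζ i ∧ ζ i < P.corner i + P.side) := by
    by_contra! h
    exact hζ (mem_interior_of_forall_lt P fun i => by simpa using h i)
  obtain ⟨h1, h2⟩ := closure_gridCube_subset hm k₀ j hy i
  rw [← le_div_iff₀ hk, div_eq_mul_one_div, ← hl] at h2
  rw [← div_le_iff₀ hk, div_eq_mul_one_div, ← hl] at h1
  obtain ⟨h3, h4⟩ := hmargin i
  have h5 := mul_le_mul_of_nonneg_right h3 hl0.le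
  have h6 := mul_le_mul_of_nonneg_right h4 hl0.le
  refine le_trans ?_ (abs_coord_sub_le_dist y ζ i)
  rw [hcorner, hPside] at hi
  rcases le_or_gt (ζ i) (p i * l) with h | h
  · refine le_trans ?_ (le_abs_self _)
    linarith
  · have h' : p i * l + m * l ≤ ζ i := not_lt.1 fun h' => hi ⟨h, h'⟩
    refine le_trans ?_ (neg_le_abs _)
    linarith

theorem dist_le_of_mem_closure_gridCube (hm : 0 < m) {k₀ : ℤ} {j : Fin n → ℤ}
    {x y : EuclideanSpace ℝ (Fin n)} (hx : x ∈ closure (gridCube n m k₀ j).toSet)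
    (hy : y ∈ closure (gridCube n m k₀ j).toSet) : dist x y ≤ √n * (1 / (m : ℝ) ^ k₀) := by
  have hk : (0 : ℝ) < (m : ℝ) ^ k₀ := zpow_pos (by exact_mod_cast hm) k₀
  refine dist_le_sqrt_mul (by positivity) fun i => ?_
  obtain ⟨h1, h2⟩ := closure_gridCube_subset hm k₀ j hx i
  obtain ⟨h3, h4⟩ := closure_gridCube_subset hm k₀ j hy i
  rw [le_div_iff₀ hk]
  nth_rewrite 1 [← abs_of_pos hk]
  rw [← abs_mul, sub_mul, abs_le]
  constructor <;> linarith

end Geometry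

/-! ### The estimate -/

section Estimate

variable {n m : ℕ} {s : ℝ}

/-- Lower bound for the functions of the upper Perron class. -/
theorem content_le_of_mem_upperPerronClass (hn : 3 ≤ n) (hm : 1 < m)
    (hξ : 0 < (m : ℝ) - xi m) (hs₁ : (n : ℝ) - 1 < s) {P : HalfOpenCube n} {k₀ : ℤ}
    {j p : Fin n → ℤ} (hcorner : ∀ i, P.corner i = p i * (1 / (m : ℝ) ^ k₀))
    (hPside : P.side = m * (1 / (m : ℝ) ^ k₀))
    (hmargin : ∀ i, (p i : ℝ) + (m - xi m) / 2 ≤ j i ∧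
      (j i : ℝ) + 1 + (m - xi m) / 2 ≤ p i + m)
    (hκ : 0 ≤ (1 / √(n : ℝ)) ^ (n - 2) - (2 / ((m : ℝ) - xi m)) ^ (n - 2))
    {E : Set (EuclideanSpace ℝ (Fin n))} (hE : IsClosed E) {X : EuclideanSpace ℝ (Fin n)}
    (hX : X ∈ closure (gridCube n m k₀ j).toSet \ E) (k : ℤ)
    {v : EuclideanSpace ℝ (Fin n) → ℝ}
    (hv : v ∈ upperPerronClass (interior P.toSet \ E)
      ((E ∩ interior P.toSet).indicator fun _ => 1)) {ε : ℝ} (hε : 0 < ε) :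
    ((1 / √(n : ℝ)) ^ (n - 2) - (2 / ((m : ℝ) - xi m)) ^ (n - 2))
        * ((netContent m s (E ∩ closure (gridCube n m k₀ j).toSet)).toReal /
          (1 / (m : ℝ) ^ k₀) ^ s)
      ≤ bourgainTerm n m s k * (v X + ε) := by
  have hm0 : (0 : ℝ) < m := by positivity
  have hm1 : (1 : ℝ) < m := by exact_mod_cast hm
  have hm' : 0 < m := by omega
  have hn3 : (3 : ℝ) ≤ n := by exact_mod_cast hn
  have hs0 : 0 < s := by linarith
  have hsn : 0 < √(n : ℝ) := Real.sqrt_pos.2 (by linarith)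
  set l : ℝ := 1 / (m : ℝ) ^ k₀ with hl
  have hl0 : 0 < l := by positivity
  set Q := interior P.toSet with hQ
  set C := (gridCube n m k₀ j).toSet with hC
  have hfar : ∀ y ∈ closure C, ∀ ζ ∉ Q, (m - xi m) / 2 * l ≤ dist y ζ := fun y hy ζ hζ =>
    mul_le_dist_of_notMem_interior hm' hcorner hPside hmargin hy hζ
  have hCQ : closure C ⊆ Q := by
    intro y hy
    by_contra h
    have := hfar y hy y h
    rw [dist_self] at this
    have : 0 < (m - xi m) / 2 * l := by positivity
    linarith
  have hQb : Bornology.IsBounded Q := (isBounded_cube P).subset interior_subset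
  set F := closure (E ∩ C) with hF
  have hFE : F ⊆ E ∩ closure C := fun x hx =>
    ⟨closure_minimal inter_subset_left hE hx, closure_mono inter_subset_right hx⟩
  have hFc : IsCompact F := isCompact_of_isClosed_isBounded isClosed_closure
    (hQb.subset fun x hx => hCQ (hFE hx).2)
  obtain ⟨δ, hδ, hcomp⟩ := exists_thickening_comparison (by omega) isOpen_interior hQb hE hFc
    (fun x hx => ⟨(hFE hx).1, hCQ (hFE hx).2⟩) hv ⟨hCQ hX.1, hX.2⟩ hε
  obtain ⟨J, hJ⟩ : ∃ J : ℕ, ((n : ℝ) - 2) * √n / 2 * (1 / (m : ℝ) ^ (k₀ + k + J)) < δ := by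
    have hlim : Tendsto (fun J : ℕ => ((n : ℝ) - 2) * √n / 2 * (1 / (m : ℝ) ^ (k₀ + k)) *
        ((m : ℝ)⁻¹) ^ J) atTop (𝓝 0) := by
      simpa using (tendsto_pow_atTop_nhds_zero_of_lt_one (by positivity)
        (inv_lt_one_of_one_lt₀ hm1)).const_mul (((n : ℝ) - 2) * √n / 2 * (1 / (m : ℝ) ^ (k₀ + k)))
    obtain ⟨J, hJ⟩ := (hlim.eventually (gt_mem_nhds hδ)).exists
    refine ⟨J, lt_of_eq_of_lt ?_ hJ⟩
    rw [zpow_add₀ hm0.ne' _ (J : ℤ), zpow_natCast, inv_pow]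
    field_simp
  -- `toNat` gives depth `0` when `k + J` is negative. Generations coarser than `k₀` are then
  -- controlled by the total mass, as in `hcell`.
  obtain ⟨ι, _, y, a, ha, hy, hsum, hM⟩ := exists_discrete_frostman hm hs0 E (k + J).toNat k₀ j
  have hyC : ∀ i, y i ∈ E ∩ C := fun i => ⟨(hy i).1, (mem_gridCube hm').2 (hy i).2⟩
  have hyF : ∀ i, y i ∈ F := fun i => subset_closure (hyC i)
  have hyCl : ∀ i, y i ∈ closure C := fun i => subset_closure (hyC i).2
  set T := ∑ i, a i with hT
  have hT0 : 0 ≤ T := Finset.sum_nonneg fun i _ => ha i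
  have htotal : T ≤ l ^ s := by
    have := hsum k₀ le_rfl (by omega) j
    rwa [Finset.filter_true_of_mem fun i _ => (hy i).2] at this
  have hcell : ∀ k' ≤ k₀ + ((k + J).toNat : ℤ), ∀ j',
      ∑ i with cellIndex m k' (y i) = j', a i ≤ (1 / (m : ℝ) ^ k') ^ s := by
    intro k' hk' j'
    rcases le_or_gt k₀ k' with h | h
    · exact hsum k' h hk' j'
    · refine (Finset.sum_le_sum_of_subset_of_nonneg (Finset.filter_subset _ _)
        fun i _ _ => ha i).trans (htotal.trans ?_)
      have : (m : ℝ) ^ k' ≤ (m : ℝ) ^ k₀ := zpow_le_zpow_right₀ hm1.le h.le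
      exact Real.rpow_le_rpow hl0.le (one_div_le_one_div_of_le (zpow_pos hm0 k') this) hs0.le
  have hB : 0 < bourgainTerm n m s k := bourgainTerm_pos hn hm (by linarith) k
  set S := bourgainTerm n m s k * (l ^ s * (l ^ (n - 2))⁻¹) with hS
  have hS0 : 0 < S := by positivity
  set b := T * ((((m : ℝ) - xi m) / 2 * l) ^ (n - 2))⁻¹ with hb
  have hb0 : 0 ≤ b := by positivity
  set u : EuclideanSpace ℝ (Fin n) → ℝ := fun x => ∑ i, a i * (dist (y i) x ^ (n - 2))⁻¹ with hu
  -- The normalised test function: subtracting `b` makes it nonpositive off `Q`, and dividing by `S`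
  -- makes it at most `1` off the thickening.
  have hg := hcomp (fun x => S⁻¹ * (u x + (-b))) ?_ ?_ ?_ ?_
  · have huX : T * ((√n * l) ^ (n - 2))⁻¹ ≤ u X := by
      rw [hT, Finset.sum_mul]
      refine Finset.sum_le_sum fun i _ => mul_le_mul_of_nonneg_left ?_ (ha i)
      have hpos : 0 < dist (y i) X := dist_pos.2 fun h => hX.2 (h ▸ (hyC i).1)
      have := dist_le_of_mem_closure_gridCube hm' (hyCl i) hX.1
      gcongr
    have hMT : (netContent m s (E ∩ closure C)).toReal ≤ T :=
      ENNReal.toReal_le_of_le_ofReal hT0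
        ((netContent_inter_closure_le hm hs0 hs₁ k₀ j E).trans hM)
    have hls : 0 < l ^ s := by positivity
    calc _ ≤ ((1 / √(n : ℝ)) ^ (n - 2) - (2 / ((m : ℝ) - xi m)) ^ (n - 2)) * (T / l ^ s) := by
          gcongr
      _ = bourgainTerm n m s k * (S⁻¹ * (T * ((√n * l) ^ (n - 2))⁻¹ + -b)) := by
          rw [hS, hb]
          simp only [mul_pow, div_pow, one_pow]
          field_simp
          ring
      _ ≤ bourgainTerm n m s k * (S⁻¹ * (u X + -b)) := by gcongr
      _ ≤ _ := mul_le_mul_of_nonneg_left hg hB.le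
  · intro x hx
    refine ContinuousAt.mul continuousAt_const (ContinuousAt.add ?_ continuousAt_const)
    refine tendsto_finsetSum _ fun i _ => ?_
    refine ContinuousAt.mul continuousAt_const (ContinuousAt.inv₀ (by fun_prop) ?_)
    exact pow_ne_zero _ (dist_ne_zero.2 fun h => hx (h ▸ hyF i))
  · intro x hx
    refine (IsAsympSubmeanAt.add (IsAsympSubmeanAt.sum _ fun i => ?_)
      (IsAsympSubmeanAt.const _ _)).const_mul (by positivity)
    exact (isAsympSubmeanAt_fundamental hn fun h : x = y i => hx (h.symm ▸ hyF i)).const_mul (ha i)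
  · intro x hx
    have hux : u x ≤ b := by
      rw [hb, hT, Finset.sum_mul]
      refine Finset.sum_le_sum fun i _ => mul_le_mul_of_nonneg_left ?_ (ha i)
      have := hfar (y i) (hyCl i) x hx
      gcongr
    exact mul_nonpos_of_nonneg_of_nonpos (by positivity) (by linarith)
  · intro x hx
    have hux : u x ≤ S := by
      refine potential_le hn hm (by linarith) k₀ k ((k + J).toNat : ℤ) J (Int.self_le_toNat _) y a
        ha htotal hcell x fun i => hJ.le.trans ?_
      by_contra! h
      exact hx (mem_thickening_iff.2 ⟨y i, hyF i, by rwa [dist_comm]⟩)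
    rw [inv_mul_le_iff₀ hS0]
    linarith

end Estimate

/-- Bourgain's estimate with better constants. The first conjunct says that the infimum defining
`O(n,m,s)` is a minimum, the second that the net content in the estimate is finite. -/
theorem lemma3p1 (n m : ℕ) (hn : 3 ≤ n) (hm : 5 ≤ m)
    (hmn : xi m + 2 * √(n : ℝ) < (m : ℝ))
    (P Pstar : HalfOpenCube n) (hP : P ∈ alignedGrid n m) (hPstar : Pstar ∈ madicGrid n m)
    (hside : Pstar.side = (m : ℝ)⁻¹ * P.side)
    (hcenter : P.center ∈ closure Pstar.toSet)
    (E : Set (EuclideanSpace ℝ (Fin n))) (hE : IsClosed E)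
    (X : EuclideanSpace ℝ (Fin n)) (hX : X ∈ closure Pstar.toSet \ E)
    (s : ℝ) (hs₁ : (n : ℝ) - 1 < s) (hs₂ : s ≤ (n : ℝ)) :
    IsLeast (Set.range (bourgainTerm n m s)) (bourgainConst n m s) ∧
    netContent m s (E ∩ closure Pstar.toSet) ≠ ⊤ ∧
    ((1 / √(n : ℝ)) ^ (n - 2) - (2 / ((m : ℝ) - xi m)) ^ (n - 2))
        * ((netContent m s (E ∩ closure Pstar.toSet)).toReal / Pstar.side ^ s)
      ≤ bourgainConst n m s
        * harmonicMeasure (interior P.toSet \ E) X (E ∩ interior P.toSet) := by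
  have hm1 : 1 < m := by omega
  have hm' : 0 < m := by omega
  have hn3 : (3 : ℝ) ≤ n := by exact_mod_cast hn
  have hs0 : 0 < s := by linarith
  have hsn : 0 < √(n : ℝ) := Real.sqrt_pos.2 (by linarith)
  have hξ : 0 < (m : ℝ) - xi m := by linarith
  obtain ⟨k₀, j, p, rfl, hcorner, hPside, hmargin⟩ :=
    aligned_cube_margins hm' hP hPstar hside hcenter
  have hleast := isLeast_bourgainConst hn hm1 (by linarith : (n : ℝ) - 2 < s)
  refine ⟨hleast, ?_, ?_⟩
  · exact ((netContent_inter_closure_le hm1 hs0 hs₁ k₀ j E).trans (netContent_le_rpow_side hm1 hs0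
      (gridCube_mem_madicGrid k₀ j) inter_subset_right)).trans_lt ENNReal.ofReal_lt_top |>.ne
  obtain ⟨k, hk⟩ := hleast.1
  have hB : 0 < bourgainConst n m s := hk ▸ bourgainTerm_pos hn hm1 (by linarith) k
  -- This is where `m > ξ + 2 * √n` enters: the margin `(m - ξ) / 2` exceeds the diameter `√n` of
  -- the small cube, in units of its side.
  have hκ : 0 ≤ (1 / √(n : ℝ)) ^ (n - 2) - (2 / ((m : ℝ) - xi m)) ^ (n - 2) := by
    refine sub_nonneg.2 (pow_le_pow_left₀ (by positivity) ?_ _)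
    rw [div_le_div_iff₀ hξ hsn]
    linarith
  -- Harmonic measure is an infimum over the upper class, so it suffices to bound every `v X` from
  -- below, up to `ε`, with the minimising `k`.
  rw [← div_le_iff₀' hB]
  refine le_csInf ((upperPerronClass_indicator_nonempty _ _).image _) ?_
  rintro _ ⟨v, hv, rfl⟩
  refine le_of_forall_pos_le_add fun ε hε => ?_
  rw [div_le_iff₀' hB, ← hk]
  exact content_le_of_mem_upperPerronClass hn hm1 hξ hs₁ hcorner hPside hmargin hκ hE hX k hv hε
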